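/- Let $n\ge 10$ and let $\mathcal T_n$ be the rank three matroid on $\mathbb Z/n\mathbb Z$ whose non-bases are the three-element subsets $\{i,j,k\}$ with $i+j+k=0$ (every other three-element subset is a basis). A realization of $\mathcal T_n$ over $\mathbb C$ is a family $\mathbf p=(p_k)_{k\in\mathbb Z/n\mathbb Z}$ of distinct points of $\mathbb P^2(\mathbb C)$ such that, for distinct $i,j,k$, the points $p_i,p_j,p_k$ are collinear if and only if $i+j+k=0$. Let $\mathfrak U\subset(\mathbb P^2_{\mathbb C})^{n}$ be the locally closed subscheme defined by the vanishing of the $3\times 3$ minors indexed by the non-bases and the non-vanishing of the minors indexed by the bases. Let $\mathcal R(\mathcal T_n)=\mathfrak U/\mathrm{PGL}_3$ be the moduli scheme of realizations. For any four distinct indices $j_1,\dots,j_4$, any three of which form a basis (for example $0,1,2,3$), it is identified with the closed subscheme of $\mathfrak U$ where $p_{j_1},\dots,p_{j_4}$ are $(1:0:0),(0:1:0),(0:0:1),(1:1:1)$; a realization $\mathbf p$ gives the point $[\mathbf p]$, its unique $\mathrm{PGL}_3(\mathbb C)$-translate of this form. Then for every realization $\mathbf p$ of $\mathcal T_n$ over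 $\mathbb C$, and every such choice of $j_1,\dots,j_4$, the Zariski tangent space $(\mathfrak m/\mathfrak m^2)^\vee$ of $\mathcal R(\mathcal T_n)$ at $[\mathbf p]$, where $\mathfrak m$ is the maximal ideal of the local ring at $[\mathbf p]$, has dimension at most one. -/

import Mathlib

open scoped LinearAlgebra.Projectivization

noncomputable section

/-! ### The cyclic matroid `T_n` -/

/-- The matroid `T_n` (`n ≥ 4`): its atoms are the elements of `ZMod n`, and an order three subset
`{i, j, k}` is a basis iff `i + j + k ≠ 0`. -/
def cyclicMatroid (n : ℕ) (hn : 4 ≤ n) : Matroid (ZMod n) :=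
  Matroid.ofExistsFiniteIsBase Set.univ
    (fun B => ∃ i j k : ZMod n, i ≠ j ∧ i ≠ k ∧ j ≠ k ∧ i + j + k ≠ 0 ∧ B = {i, j, k})
    (by
      have h : ∀ m : ℕ, 0 < m → m < n → (m : ZMod n) ≠ 0 := by
        intro m hm hmn h0
        rw [ZMod.natCast_eq_zero_iff] at h0
        exact absurd (Nat.le_of_dvd hm h0) (by omega)
      have h1 := h 1 (by omega) (by omega)
      have h2 := h 2 (by omega) (by omega)
      have h3 := h 3 (by omega) (by omega)
      push_cast at h1 h2 h3
      refine ⟨{0, 1, 2}, ⟨0, 1, 2, h1.symm, h2.symm, ?_, ?_, rfl⟩, by simp⟩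
      · intro h'
        apply h1
        linear_combination -h'
      · intro h'
        apply h3
        linear_combination h')
    (by
      have main : ∀ x y a : ZMod n, x ≠ y → a ≠ x → a ≠ y → ∀ B : Set (ZMod n),
          (∃ i j k : ZMod n, i ≠ j ∧ i ≠ k ∧ j ≠ k ∧ i + j + k ≠ 0 ∧ B = {i, j, k}) →
          a ∉ B → ∃ b ∈ B, b ≠ a ∧ b ≠ x ∧ b ≠ y ∧ x + y + b ≠ 0 := by
        rintro x y a hxy hax hay B ⟨i, j, k, hij, hik, hjk, hs, rfl⟩ ha
        simp only [Set.mem_insert_iff, Set.mem_singleton_iff, not_or] at ha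
        obtain ⟨hi, hj, hk⟩ := ha
        by_contra! hc
        have e : ∀ b ∈ ({i, j, k} : Set (ZMod n)), b ≠ a → b = x ∨ b = y ∨ b = -x - y := by
          intro b hb hba
          by_cases h1 : b = x
          · exact Or.inl h1
          by_cases h2 : b = y
          · exact Or.inr (Or.inl h2)
          · exact Or.inr (Or.inr (by linear_combination hc b hb hba h1 h2))
        apply hs
        rcases e i (by simp) (Ne.symm hi) with h1 | h1 | h1 <;>
        rcases e j (by simp) (Ne.symm hj) with h2 | h2 | h2 <;>
        rcases e k (by simp) (Ne.symm hk) with h3 | h3 | h3 <;>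
        first
        | exact absurd (h1.trans h2.symm) hij
        | exact absurd (h1.trans h3.symm) hik
        | exact absurd (h2.trans h3.symm) hjk
        | linear_combination h1 + h2 + h3
      rintro A B ⟨i, j, k, hij, hik, hjk, hs, rfl⟩ hB a ⟨haA, haB⟩
      have key : ∀ x y, x ≠ y → a ≠ x → a ≠ y → ({i, j, k} : Set (ZMod n)) = {a, x, y} →
          ∃ b ∈ B \ {i, j, k}, ∃ i' j' k' : ZMod n, i' ≠ j' ∧ i' ≠ k' ∧ j' ≠ k' ∧
            i' + j' + k' ≠ 0 ∧ insert b (({i, j, k} : Set (ZMod n)) \ {a}) = {i', j', k'} := by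
        intro x y hxy hax hay hA
        obtain ⟨b, hb, hba, hbx, hby, hsum⟩ := main x y a hxy hax hay B hB haB
        rw [hA]
        refine ⟨b, ⟨hb, by simp [hba, hbx, hby]⟩, b, x, y, hbx, hby, hxy, ?_, ?_⟩
        · intro h
          apply hsum
          linear_combination h
        · congr 1
          ext z
          simp only [Set.mem_sdiff, Set.mem_insert_iff, Set.mem_singleton_iff]
          constructor
          · rintro ⟨h1 | h1 | h1, h2⟩
            · exact absurd h1 h2
            · exact Or.inl h1
            · exact Or.inr h1
          · rintro (h1 | h1)
            · exact ⟨Or.inr (Or.inl h1), fun h => hax (h.symm.trans h1)⟩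
            · exact ⟨Or.inr (Or.inr h1), fun h => hay (h.symm.trans h1)⟩
      rcases haA with h | h | h
      · exact key j k hjk (h ▸ hij) (h ▸ hik) (by rw [h])
      · exact key i k hik (h ▸ hij.symm) (h ▸ hjk) (by rw [h, Set.insert_comm])
      · have h : a = k := h
        exact key i j hij (h ▸ hik.symm) (h ▸ hjk.symm)
          (by rw [h]; ext z; simp only [Set.mem_insert_iff, Set.mem_singleton_iff]; tauto))
    (fun _ _ => Set.subset_univ _)

/-! ### Realizations of a rank three matroid, and the moduli space of realizations -/

namespace MatroidRealization

universe u v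

variable {E : Type u}

/-- The determinant `|c_i, c_j, c_k|` of three columns of a matrix with three rows and with
columns indexed by `E` (`c e a` is the entry in column `e` and row `a`). -/
def minor {R : Type*} [CommRing R] (c : E → Fin 3 → R) (i j k : E) : R :=
  Matrix.det (Matrix.of ![c i, c j, c k])

/-- A realization over `K` of a rank three matroid `M`: a family of distinct points of the
projective plane, labelled by the atoms, such that an order three set of atoms is a non-basis
iff the corresponding minor vanishes. -/
structure Realization (M : Matroid E) (K : Type v) [Field K] where
  point : E → ℙ K (Fin 3 → K)
  injective : Function.Injective point
  minor_eq_zero_iff : ∀ i j k : E, i ≠ j → i ≠ k → j ≠ k →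
    (minor (fun e => (point e).rep) i j k = 0 ↔ ¬ M.IsBase {i, j, k})

/-- Four distinct atoms, any three of which form a basis. -/
structure Frame (M : Matroid E) where
  atom : Fin 4 → E
  injective : Function.Injective atom
  isBase : ∀ a b c : Fin 4, a ≠ b → a ≠ c → b ≠ c → M.IsBase {atom a, atom b, atom c}

/-- The canonical basis `(1:0:0), (0:1:0), (0:0:1), (1:1:1)`. -/
def canonicalVec (K : Type v) [Field K] : Fin 4 → Fin 3 → K :=
  ![![1, 0, 0], ![0, 1, 0], ![0, 0, 1], ![1, 1, 1]]

lemma canonicalVec_ne_zero (K : Type v) [Field K] (a : Fin 4) : canonicalVec K a ≠ 0 := by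
  intro h
  fin_cases a
  · simpa [canonicalVec] using congrFun h 0
  · simpa [canonicalVec] using congrFun h 1
  · simpa [canonicalVec] using congrFun h 2
  · simpa [canonicalVec] using congrFun h 0

/-- The `K`-points of the moduli space `R(M)` of realizations of `M` modulo projective
transformations, where `R(M)` is identified with the scheme of those realizations whose points at
the four atoms of the frame `j` are the canonical basis. -/
structure ModuliPoint (M : Matroid E) (K : Type v) [Field K] (j : Frame M)
    extends Realization M K where
  point_frame : ∀ a, point (j.atom a) =
    Projectivization.mk K (canonicalVec K a) (canonicalVec_ne_zero K a)

lemma minor_smul_map {K : Type v} [Field K] (g : (Fin 3 → K) ≃ₗ[K] (Fin 3 → K))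
    (p : E → ℙ K (Fin 3 → K)) (i j k : E) :
    minor (fun e => (g • p e).rep) i j k = 0 ↔ minor (fun e => (p e).rep) i j k = 0 := by
  have h : ∀ e, ∃ u : Kˣ, u • g (p e).rep = (g • p e).rep := by
    intro e
    have h1 : g • p e = Projectivization.mk K (g (p e).rep)
        (by simpa using (p e).rep_nonzero) := by
      conv_lhs => rw [← Projectivization.mk_rep (p e)]
      rfl
    have h2 := (Projectivization.mk_rep (g • p e)).trans h1
    exact (Projectivization.mk_eq_mk_iff K _ _ _ _).1 h2
  choose u hu using h
  have h3 : ∀ c : E → Fin 3 → K, minor c i j k ≠ 0 ↔ LinearIndependent K ![c i, c j, c k] := by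
    intro c
    rw [minor, ← isUnit_iff_ne_zero, ← Matrix.isUnit_iff_isUnit_det,
      ← Matrix.linearIndependent_rows_iff_isUnit]
    rfl
  rw [← not_iff_not]
  change minor _ i j k ≠ 0 ↔ minor _ i j k ≠ 0
  rw [h3, h3]
  have h4 : ![(g • p i).rep, (g • p j).rep, (g • p k).rep] =
      ![u i, u j, u k] • (g ∘ ![(p i).rep, (p j).rep, (p k).rep]) := by
    ext a b
    fin_cases a
    · simpa using (congrFun (hu i) b).symm
    · simpa using (congrFun (hu j) b).symm
    · simpa using (congrFun (hu k) b).symm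
  rw [h4, LinearIndependent.units_smul_iff]
  exact LinearMap.linearIndependent_iff_of_injOn g.toLinearMap g.injective.injOn

/-- The realization obtained by applying a projective transformation. -/
def Realization.map {M : Matroid E} {K : Type v} [Field K] (P : Realization M K)
    (g : (Fin 3 → K) ≃ₗ[K] (Fin 3 → K)) : Realization M K where
  point e := g • P.point e
  injective _ _ h := P.injective (smul_left_cancel g h)
  minor_eq_zero_iff i j k hij hik hjk :=
    (minor_smul_map g P.point i j k).trans (P.minor_eq_zero_iff i j k hij hik hjk)

lemma exists_normalization {M : Matroid E} {K : Type v} [Field K] (P : Realization M K)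
    (j : Frame M) : ∃ g : (Fin 3 → K) ≃ₗ[K] (Fin 3 → K), ∀ a, (P.map g).point (j.atom a) =
      Projectivization.mk K (canonicalVec K a) (canonicalVec_ne_zero K a) := by
  have hli : ∀ a b c : Fin 4, a ≠ b → a ≠ c → b ≠ c → LinearIndependent K
      ![(P.point (j.atom a)).rep, (P.point (j.atom b)).rep, (P.point (j.atom c)).rep] := by
    intro a b c hab hac hbc
    have h1 : minor (fun e => (P.point e).rep) (j.atom a) (j.atom b) (j.atom c) ≠ 0 := by
      rw [Ne, P.minor_eq_zero_iff _ _ _ (j.injective.ne hab) (j.injective.ne hac)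
        (j.injective.ne hbc), not_not]
      exact j.isBase a b c hab hac hbc
    rw [minor, ← isUnit_iff_ne_zero, ← Matrix.isUnit_iff_isUnit_det,
      ← Matrix.linearIndependent_rows_iff_isUnit] at h1
    exact h1
  set r : Fin 4 → Fin 3 → K := fun a => (P.point (j.atom a)).rep with hr
  let B : Module.Basis (Fin 3) K (Fin 3 → K) :=
    basisOfLinearIndependentOfCardEqFinrank
      (hli 0 1 2 (by decide) (by decide) (by decide)) (by simp)
  have hB : ⇑B = ![r 0, r 1, r 2] := coe_basisOfLinearIndependentOfCardEqFinrank _ _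
  have hsum : r 3 = B.repr (r 3) 0 • r 0 + B.repr (r 3) 1 • r 1 + B.repr (r 3) 2 • r 2 := by
    have := (B.sum_repr (r 3)).symm
    rw [Fin.sum_univ_three, hB] at this
    simpa using this
  have hne : ∀ a, B.repr (r 3) a ≠ 0 := by
    have key : ∀ x y : Fin 4, x ≠ y → x ≠ 3 → y ≠ 3 → ∀ s t : K, r 3 ≠ s • r x + t • r y := by
      intro x y hxy hx hy s t h
      have h1 := Fintype.linearIndependent_iff.1 (hli x y 3 hxy hx hy) ![s, t, -1]
        (by
          rw [Fin.sum_univ_three]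
          change s • r x + t • r y + (-1 : K) • r 3 = 0
          rw [h]
          module) 2
      simp at h1
    intro a ha
    fin_cases a
    · refine key 1 2 (by decide) (by decide) (by decide)
        (B.repr (r 3) 1) (B.repr (r 3) 2) ?_
      conv_lhs => rw [hsum]
      rw [show B.repr (r 3) 0 = 0 from ha, zero_smul, zero_add]
    · refine key 0 2 (by decide) (by decide) (by decide)
        (B.repr (r 3) 0) (B.repr (r 3) 2) ?_
      conv_lhs => rw [hsum]
      rw [show B.repr (r 3) 1 = 0 from ha, zero_smul, add_zero]
    · refine key 0 1 (by decide) (by decide) (by decide)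
        (B.repr (r 3) 0) (B.repr (r 3) 1) ?_
      conv_lhs => rw [hsum]
      rw [show B.repr (r 3) 2 = 0 from ha, zero_smul, add_zero]
  let B' := B.unitsSMul fun a => Units.mk0 _ (hne a)
  have hg : ∀ a, ∃ u : Kˣ, u • canonicalVec K a = B'.equivFun (r a) := by
    have h0 : ∀ a : Fin 3, B'.equivFun (B a) = (B.repr (r 3) a)⁻¹ • Pi.single a (1 : K) := by
      intro a
      have : B a = (B.repr (r 3) a)⁻¹ • B' a := by
        simp [B', Module.Basis.unitsSMul_apply, Units.smul_def, smul_smul, hne a]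
      rw [this, map_smul]
      congr 1
      ext b
      rw [Module.Basis.equivFun_self, Pi.single_apply]
      simp [eq_comm]
    have hb : ∀ a : Fin 3, B a = ![r 0, r 1, r 2] a := fun a => congrFun hB a
    intro a
    fin_cases a
    · refine ⟨Units.mk0 _ (inv_ne_zero (hne 0)), ?_⟩
      have := h0 0
      rw [hb] at this
      refine Eq.trans ?_ this.symm
      ext b; fin_cases b <;> simp [canonicalVec, Units.smul_def]
    · refine ⟨Units.mk0 _ (inv_ne_zero (hne 1)), ?_⟩
      have := h0 1
      rw [hb] at this
      refine Eq.trans ?_ this.symm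
      ext b; fin_cases b <;> simp [canonicalVec, Units.smul_def]
    · refine ⟨Units.mk0 _ (inv_ne_zero (hne 2)), ?_⟩
      have := h0 2
      rw [hb] at this
      refine Eq.trans ?_ this.symm
      ext b; fin_cases b <;> simp [canonicalVec, Units.smul_def]
    · refine ⟨1, ?_⟩
      have : B'.equivFun (r 3) = ∑ a, B.repr (r 3) a • B'.equivFun (B a) := by
        conv_lhs => rw [← B.sum_repr (r 3)]
        simp only [map_sum, map_smul]
      refine Eq.trans ?_ this.symm
      simp only [h0, smul_smul, mul_inv_cancel₀ (hne _), Fin.sum_univ_three]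
      ext b; fin_cases b <;> simp [canonicalVec]
  refine ⟨B'.equivFun, fun a => ?_⟩
  obtain ⟨u, hu⟩ := hg a
  have h1 : (P.map B'.equivFun).point (j.atom a) = Projectivization.mk K (B'.equivFun (r a))
      (by simpa using (P.point (j.atom a)).rep_nonzero) := by
    change B'.equivFun • P.point (j.atom a) = _
    conv_lhs => rw [← Projectivization.mk_rep (P.point (j.atom a))]
    rfl
  rw [h1]
  exact (Projectivization.mk_eq_mk_iff K _ _ _ _).2 ⟨u, hu⟩

/-- The class `[P]` of a realization `P` in the moduli space: the representative `g • P`,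
`g ∈ PGL₃(K)`, whose points at the frame are the canonical basis. -/
def Realization.toModuliPoint {M : Matroid E} {K : Type v} [Field K] (P : Realization M K)
    (j : Frame M) : ModuliPoint M K j where
  toRealization := P.map (exists_normalization P j).choose
  point_frame := (exists_normalization P j).choose_spec

/-! ### The local rings and Zariski tangent spaces of the moduli space -/

/-- The coordinate ring of `3 × E` matrices over `K`: the multihomogeneous coordinate ring of
`(ℙ²)^E`. The variable `X (e, a)` is the entry of the generic matrix in column `e`, row `a`. -/
abbrev CoordRing (E : Type u) (K : Type v) [Field K] := MvPolynomial (E × Fin 3) K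

/-- The grading of the coordinate ring of `(ℙ²)^E` by multidegrees `E →₀ ℕ`. -/
abbrev multigrading (E : Type u) [DecidableEq E] (K : Type v) [Field K] :
    (E →₀ ℕ) → Submodule K (CoordRing E K) :=
  MvPolynomial.weightedHomogeneousSubmodule K
    (fun x : E × Fin 3 => (Finsupp.single x.1 1 : E →₀ ℕ))

instance (E : Type u) [DecidableEq E] (K : Type v) [Field K] : GradedAlgebra (multigrading E K) :=
  MvPolynomial.weightedGradedAlgebra K _

/-- The multihomogeneous ideal defining the closure of `R(M)` in `(ℙ²)^E`: it is generated by the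
minors of the non-bases and by the equations (`2 × 2` minors) saying that the points at the frame
are the canonical basis. The moduli space `R(M)` is the closed subscheme of `(ℙ²)^E` defined by
this ideal, minus the vanishing loci of the minors of the bases. -/
def equations (M : Matroid E) (K : Type v) [Field K] (j : Frame M) : Ideal (CoordRing E K) :=
  Ideal.span
    ({f | ∃ i₁ i₂ i₃ : E, i₁ ≠ i₂ ∧ i₁ ≠ i₃ ∧ i₂ ≠ i₃ ∧ ¬ M.IsBase {i₁, i₂, i₃} ∧
        f = minor (fun e a => (MvPolynomial.X (e, a) : CoordRing E K)) i₁ i₂ i₃} ∪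
     {f | ∃ (a : Fin 4) (b c : Fin 3),
        f = MvPolynomial.C (canonicalVec K a b) * MvPolynomial.X (j.atom a, c) -
          MvPolynomial.C (canonicalVec K a c) * MvPolynomial.X (j.atom a, b)})

/-- Evaluation of polynomials in the coordinates at a family of points of the projective plane
(through homogeneous coordinates of the points). -/
def evalAt {K : Type v} [Field K] (p : E → ℙ K (Fin 3 → K)) : CoordRing E K →+* K :=
  MvPolynomial.eval fun x => (p x.1).rep x.2

instance {K : Type v} [Field K] (p : E → ℙ K (Fin 3 → K)) :
    (RingHom.ker (evalAt p)).IsPrime := RingHom.ker_isPrime _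

/-- The local ring of `(ℙ²)^E` at the point `p`: the ring of fractions `f / h` where `f` and `h` are
multihomogeneous of the same multidegree and `h(p) ≠ 0`. -/
abbrev AmbientLocalRing [DecidableEq E] {K : Type v} [Field K] (p : E → ℙ K (Fin 3 → K)) :=
  HomogeneousLocalization.AtPrime (multigrading E K) (RingHom.ker (evalAt p))

/-- The ideal of `R(M)` in the local ring of `(ℙ²)^E` at a point of `R(M)`. -/
def localIdeal [DecidableEq E] {M : Matroid E} {K : Type v} [Field K] {j : Frame M}
    (Q : ModuliPoint M K j) : Ideal (AmbientLocalRing Q.point) :=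
  Ideal.span {z | ∃ c : HomogeneousLocalization.NumDenSameDeg (multigrading E K)
    (RingHom.ker (evalAt Q.point)).primeCompl,
      (c.num : CoordRing E K) ∈ equations M K j ∧ z = HomogeneousLocalization.mk c}

/-- The local ring of the scheme `R(M)` at a `K`-point. -/
abbrev LocalRing [DecidableEq E] {M : Matroid E} {K : Type v} [Field K] {j : Frame M}
    (Q : ModuliPoint M K j) := AmbientLocalRing Q.point ⧸ localIdeal Q

lemma equations_le_ker {M : Matroid E} {K : Type v} [Field K] {j : Frame M}
    (Q : ModuliPoint M K j) : equations M K j ≤ RingHom.ker (evalAt Q.point) := by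
  rw [equations, Ideal.span_le]
  rintro f (⟨i₁, i₂, i₃, h12, h13, h23, hM, rfl⟩ | ⟨a, b, c, rfl⟩)
  · have h := (Q.minor_eq_zero_iff i₁ i₂ i₃ h12 h13 h23).2 hM
    change evalAt Q.point _ = 0
    rw [← h, minor, minor, Matrix.det_fin_three, Matrix.det_fin_three]
    simp [evalAt]
  · obtain ⟨u, hu⟩ := (Projectivization.mk_eq_mk_iff K _ _ (Q.point (j.atom a)).rep_nonzero
      (canonicalVec_ne_zero K a)).1 ((Projectivization.mk_rep _).trans (Q.point_frame a))
    change evalAt Q.point _ = 0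
    simp only [evalAt, map_sub, map_mul, MvPolynomial.eval_C, MvPolynomial.eval_X, ← hu,
      Units.smul_def, Pi.smul_apply, smul_eq_mul]
    ring

lemma localIdeal_ne_top [DecidableEq E] {M : Matroid E} {K : Type v} [Field K] {j : Frame M}
    (Q : ModuliPoint M K j) : localIdeal Q ≠ ⊤ := by
  refine ne_top_of_le_ne_top
    (IsLocalRing.maximalIdeal.isMaximal (AmbientLocalRing Q.point)).ne_top ?_
  rw [localIdeal, Ideal.span_le]
  rintro z ⟨c, hc, rfl⟩
  rw [SetLike.mem_coe, IsLocalRing.mem_maximalIdeal, mem_nonunits_iff,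
    ← HomogeneousLocalization.isUnit_iff_isUnit_val, HomogeneousLocalization.val_mk,
    Localization.mk_eq_mk', IsLocalization.AtPrime.isUnit_mk'_iff _ (RingHom.ker (evalAt Q.point))]
  exact fun h => h (equations_le_ker Q hc)

instance [DecidableEq E] {M : Matroid E} {K : Type v} [Field K] {j : Frame M}
    (Q : ModuliPoint M K j) : IsLocalRing (LocalRing Q) :=
  haveI : Nontrivial (LocalRing Q) := Ideal.Quotient.nontrivial_iff.2 (localIdeal_ne_top Q)
  IsLocalRing.of_surjective' (Ideal.Quotient.mk (localIdeal Q)) Ideal.Quotient.mk_surjective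

/-- The Zariski tangent space of `R(M)` at a `K`-point: the dual of `𝔪 / 𝔪²`, where `𝔪` is the
maximal ideal of the local ring, over the residue field. -/
abbrev TangentSpace [DecidableEq E] {M : Matroid E} {K : Type v} [Field K] {j : Frame M}
    (Q : ModuliPoint M K j) :=
  Module.Dual (IsLocalRing.ResidueField (LocalRing Q)) (IsLocalRing.CotangentSpace (LocalRing Q))

end MatroidRealization

end

/-! The points of a realization lie on a plane cubic. Ternary cubics have ten coefficients, so one
passes through the nine points with indices `-5, …, 3`. The Cayley–Bacharach theorem (`chasles`),
applied to `3 × 3` arrays of distinct residues with zero row and column sums, forces it through the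
other points one at a time. The cubic contains no line of the arrangement, so it is smooth at every
point. Heuristically, a realization embeds `ℤ/n` in the group of smooth points of a cubic. Torsion
points cannot move on a fixed curve, so the only remaining parameter is the modulus of the cubic.

The proof makes this infinitesimal while keeping one cubic `c` fixed. Let `q` be a first order
deformation of `p` fixing the frame and one nonzero coordinate of each point, and let `A` be a `3 ×
3` matrix. To `(q, A)` attach the nine derivatives of `c` at `p s` in the direction `q s + A (p s)`.
If the kernel of this linear map consists of scalar matrices with `q = 0`, then `dim {q} + 9 ≤ 9 +
1`, which is the bound (`CyclicArrangement.rank_deformationSpace_le`).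

In the kernel, nine points stay on `c` to first order. Since `chasles` holds over any commutative
ring under unit hypotheses, it applies to the dual numbers, and all points stay on `c`. The motion
of `p k` along the curve is measured by a scalar `v k`, its value under the invariant differential.
Differentiating collinearity gives `v i + v j + v k = 0` on zero sum triples, an infinitesimal Abel
theorem, and in characteristic zero this forces `v = 0` (`eq_zero_of_zero_sum_triples`). So `q k + A
(p k)` is proportional to `p k`; the frame makes `A` scalar, and the normalization gives `q = 0`.

Finally, `rank_dual_cotangentSpace_le` reads cotangent functionals as homomorphisms to the dual
numbers, whose derivatives at the affine coordinates form such a `q`. -/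

noncomputable section

/-! ### Brackets and plane cubics over a commutative ring -/

section Cubic

variable {R : Type*} [CommRing R]

/-- The determinant of three vectors of length three. -/
def bracket (u v w : Fin 3 → R) : R :=
  u 0 * (v 1 * w 2 - v 2 * w 1) - u 1 * (v 0 * w 2 - v 2 * w 0) + u 2 * (v 0 * w 1 - v 1 * w 0)

/-- The ternary cubic form with coefficients `c`. -/
def cubic (c : Fin 10 → R) (v : Fin 3 → R) : R :=
  c 0 * v 0 ^ 3 + c 1 * v 1 ^ 3 + c 2 * v 2 ^ 3 + c 3 * (v 0 ^ 2 * v 1) + c 4 * (v 0 * v 1 ^ 2) +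
    c 5 * (v 0 ^ 2 * v 2) + c 6 * (v 0 * v 2 ^ 2) + c 7 * (v 1 ^ 2 * v 2) + c 8 * (v 1 * v 2 ^ 2) +
    c 9 * (v 0 * v 1 * v 2)

/-- The gradient of the cubic form `cubic c`. -/
def cubicGrad (c : Fin 10 → R) (u : Fin 3 → R) : Fin 3 → R :=
  ![3 * c 0 * u 0 ^ 2 + 2 * c 3 * u 0 * u 1 + c 4 * u 1 ^ 2 + 2 * c 5 * u 0 * u 2 + c 6 * u 2 ^ 2 +
      c 9 * u 1 * u 2,
    3 * c 1 * u 1 ^ 2 + c 3 * u 0 ^ 2 + 2 * c 4 * u 0 * u 1 + 2 * c 7 * u 1 * u 2 + c 8 * u 2 ^ 2 +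
      c 9 * u 0 * u 2,
    3 * c 2 * u 2 ^ 2 + c 5 * u 0 ^ 2 + 2 * c 6 * u 0 * u 2 + c 7 * u 1 ^ 2 + 2 * c 8 * u 1 * u 2 +
      c 9 * u 0 * u 1]

/-- The derivative of `cubic c` at `u` in the direction `w`. -/
def cubicPolar (c : Fin 10 → R) (u w : Fin 3 → R) : R :=
  cubicGrad c u 0 * w 0 + cubicGrad c u 1 * w 1 + cubicGrad c u 2 * w 2

/-- The full polarization of `cubic c`, normalized as the coefficient of `xyz` in
`cubic c (x • u + y • v + z • w)`. -/
def cubicPolarization (c : Fin 10 → R) (u v w : Fin 3 → R) : R :=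
  6 * c 0 * u 0 * v 0 * w 0 + 6 * c 1 * u 1 * v 1 * w 1 + 6 * c 2 * u 2 * v 2 * w 2 +
    2 * c 3 * (u 0 * v 0 * w 1 + u 0 * v 1 * w 0 + u 1 * v 0 * w 0) +
    2 * c 4 * (u 1 * v 1 * w 0 + u 1 * v 0 * w 1 + u 0 * v 1 * w 1) +
    2 * c 5 * (u 0 * v 0 * w 2 + u 0 * v 2 * w 0 + u 2 * v 0 * w 0) +
    2 * c 6 * (u 2 * v 2 * w 0 + u 2 * v 0 * w 2 + u 0 * v 2 * w 2) +
    2 * c 7 * (u 1 * v 1 * w 2 + u 1 * v 2 * w 1 + u 2 * v 1 * w 1) +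
    2 * c 8 * (u 2 * v 2 * w 1 + u 2 * v 1 * w 2 + u 1 * v 2 * w 2) +
    c 9 * (u 0 * v 1 * w 2 + u 0 * v 2 * w 1 + u 1 * v 0 * w 2 + u 1 * v 2 * w 0 +
      u 2 * v 0 * w 1 + u 2 * v 1 * w 0)

/-- The coefficients of a cubic form after a linear change of coordinates. -/
def cubicChange (c : Fin 10 → R) (u v w : Fin 3 → R) : Fin 10 → R :=
  ![cubic c u, cubic c v, cubic c w, cubicPolar c u v, cubicPolar c v u, cubicPolar c u w,
    cubicPolar c w u, cubicPolar c v w, cubicPolar c w v, cubicPolarization c u v w]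

theorem cubic_comb (c : Fin 10 → R) (u v w : Fin 3 → R) (x y z : R) :
    cubic c (x • u + y • v + z • w) = cubic (cubicChange c u v w) ![x, y, z] := by
  simp [cubic, cubicChange, cubicPolar, cubicGrad, cubicPolarization]
  ring

theorem cubic_comb_two (c : Fin 10 → R) (u v : Fin 3 → R) (x y : R) :
    cubic c (x • u + y • v) = x ^ 3 * cubic c u + y ^ 3 * cubic c v +
      x ^ 2 * y * cubicPolar c u v + x * y ^ 2 * cubicPolar c v u := by
  simp [cubic, cubicPolar, cubicGrad]
  ring

theorem cubic_smul (c : Fin 10 → R) (v : Fin 3 → R) (x : R) :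
    cubic c (x • v) = x ^ 3 * cubic c v := by
  simp [cubic]
  ring

theorem cubicPolar_self (c : Fin 10 → R) (v : Fin 3 → R) :
    cubicPolar c v v = 3 * cubic c v := by
  simp [cubic, cubicPolar, cubicGrad]
  ring

/-- Cramer's rule with the denominator cleared, so that it needs no invertibility. -/
theorem bracket_cramer (u v w x : Fin 3 → R) :
    bracket u v w • x = bracket x v w • u + bracket u x w • v + bracket u v x • w := by
  ext i
  fin_cases i <;> simp [bracket] <;> ring

theorem bracket_comb (u v w : Fin 3 → R) (x y z : Fin 3 → R) :
    bracket (x 0 • u + x 1 • v + x 2 • w) (y 0 • u + y 1 • v + y 2 • w)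
      (z 0 • u + z 1 • v + z 2 • w) = bracket x y z * bracket u v w := by
  simp [bracket]
  ring

/-- Vieta's formulas by successive divided differences. Over a ring, distinctness of the roots has
to mean that their differences are units. -/
theorem eq_of_monic_cubic_roots {a b c d s t r : R} (hst : IsUnit (s - t)) (hsr : IsUnit (s - r))
    (htr : IsUnit (t - r)) (h1 : a + b * s + c * s ^ 2 + d * s ^ 3 = 0)
    (h2 : a + b * t + c * t ^ 2 + d * t ^ 3 = 0) (h3 : a + b * r + c * r ^ 2 + d * r ^ 3 = 0) :
    c = -d * (s + t + r) ∧ b = d * (s * t + s * r + t * r) ∧ a = -d * (s * t * r) := by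
  have e1 : b + c * (s + t) + d * (s ^ 2 + s * t + t ^ 2) = 0 := by
    apply hst.mul_left_cancel
    linear_combination h1 - h2
  have e2 : b + c * (s + r) + d * (s ^ 2 + s * r + r ^ 2) = 0 := by
    apply hsr.mul_left_cancel
    linear_combination h1 - h3
  have e3 : c + d * (s + t + r) = 0 := by
    apply htr.mul_left_cancel
    linear_combination e1 - e2
  refine ⟨by linear_combination e3, by linear_combination e1 - (s + t) * e3, ?_⟩
  linear_combination h1 - s * e1 + s * t * e3

/-- Two rows lie on `x = 0` and `y = 0`, and the columns are the lines `z = s b * y + t b * x`. By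
Vieta on the two rows, `c` minus `c 2` times the product of the three column forms vanishes on both
rows, hence equals `x * y` times a linear form. This form vanishes at two points of the remaining
row, hence at the third, which is a combination of them. -/
theorem chasles_affine (c : Fin 10 → R) (s t X Y : Fin 3 → R) (l m : R)
    (hs : ∀ a b, a ≠ b → IsUnit (s a - s b)) (ht : ∀ a b, a ≠ b → IsUnit (t a - t b))
    (hX1 : IsUnit (X 1)) (hX2 : IsUnit (X 2)) (hY1 : IsUnit (Y 1)) (hY2 : IsUnit (Y 2))
    (h2 : ∀ b, cubic c ![0, 1, s b] = 0) (h3 : ∀ b, cubic c ![1, 0, t b] = 0)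
    (h11 : cubic c ![X 1, Y 1, s 1 * Y 1 + t 1 * X 1] = 0)
    (h12 : cubic c ![X 2, Y 2, s 2 * Y 2 + t 2 * X 2] = 0)
    (hX : X 0 = l * X 1 + m * X 2) (hY : Y 0 = l * Y 1 + m * Y 2)
    (hZ : s 0 * Y 0 + t 0 * X 0 = l * (s 1 * Y 1 + t 1 * X 1) + m * (s 2 * Y 2 + t 2 * X 2)) :
    cubic c ![X 0, Y 0, s 0 * Y 0 + t 0 * X 0] = 0 := by
  have k2 : ∀ b, c 1 + c 7 * s b + c 8 * s b ^ 2 + c 2 * s b ^ 3 = 0 := by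
    intro b
    have := h2 b
    simp [cubic] at this
    linear_combination this
  have k3 : ∀ b, c 0 + c 5 * t b + c 6 * t b ^ 2 + c 2 * t b ^ 3 = 0 := by
    intro b
    have := h3 b
    simp [cubic] at this
    linear_combination this
  obtain ⟨e8, e7, e1⟩ := eq_of_monic_cubic_roots (hs 0 1 (by decide)) (hs 0 2 (by decide))
    (hs 1 2 (by decide)) (k2 0) (k2 1) (k2 2)
  obtain ⟨e6, e5, e0⟩ := eq_of_monic_cubic_roots (ht 0 1 (by decide)) (ht 0 2 (by decide))
    (ht 1 2 (by decide)) (k3 0) (k3 1) (k3 2)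
  have key : ∀ x y z : R, cubic c ![x, y, z] =
      c 2 * ((z - (s 0 * y + t 0 * x)) * (z - (s 1 * y + t 1 * x)) * (z - (s 2 * y + t 2 * x))) +
      x * (y * ((c 3 + c 2 * (s 0 * t 1 * t 2 + t 0 * s 1 * t 2 + t 0 * t 1 * s 2)) * x +
        (c 4 + c 2 * (t 0 * s 1 * s 2 + s 0 * t 1 * s 2 + s 0 * s 1 * t 2)) * y +
        (c 9 - c 2 * (s 0 * t 1 + t 0 * s 1 + s 0 * t 2 + t 0 * s 2 + s 1 * t 2 + t 1 * s 2)) *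
          z)) := by
    intro x y z
    simp only [cubic, e8, e7, e1, e6, e5, e0]
    simp
    ring
  rw [key, sub_self] at h11 h12 ⊢
  simp only [zero_mul, mul_zero, zero_add] at h11 h12 ⊢
  have g1 := hY1.mul_left_eq_zero.1 ((mul_comm _ _).trans (hX1.mul_left_eq_zero.1
    ((mul_comm _ _).trans h11)))
  have g2 := hY2.mul_left_eq_zero.1 ((mul_comm _ _).trans (hX2.mul_left_eq_zero.1
    ((mul_comm _ _).trans h12)))
  rw [hZ]
  rw [hX, hY]
  linear_combination (l * X 1 + m * X 2) * (l * Y 1 + m * Y 2) * (l * g1 + m * g2)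

end Cubic

/-! ### Cayley–Bacharach over a commutative ring -/

section Chasles

variable {R : Type*} [CommRing R]

theorem cubic_eq_zero_of_smul (c : Fin 10 → R) {v v' : Fin 3 → R} {r : R} (hr : IsUnit r)
    (h : v = r • v') (hv : cubic c v = 0) : cubic c v' = 0 := by
  rw [h, cubic_smul] at hv
  exact (hr.pow 3).mul_right_eq_zero.1 hv

/-- The Cayley–Bacharach theorem for the nine intersection points of two triples of lines. -/
theorem chasles (c : Fin 10 → R) (x : Fin 3 → Fin 3 → Fin 3 → R)
    (hrow : ∀ a, bracket (x a 0) (x a 1) (x a 2) = 0)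
    (hcol : ∀ b, bracket (x 0 b) (x 1 b) (x 2 b) = 0)
    (hunit : ∀ a a' b b' b'', a ≠ a' → b ≠ b' → IsUnit (bracket (x a b) (x a b') (x a' b'')))
    (h0 : ∀ a b, ¬ (a = 0 ∧ b = 0) → cubic c (x a b) = 0) : cubic c (x 0 0) = 0 := by
  set p := bracket (x 2 0) (x 2 1) (x 1 0) with hp
  set q := bracket (x 1 0) (x 1 1) (x 2 0) with hq
  have up : IsUnit p := hunit _ _ _ _ _ (by decide) (by decide)
  have uq : IsUnit q := hunit _ _ _ _ _ (by decide) (by decide)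
  -- The intersection of the lines of rows 1 and 2. In the basis `x 2 0`, `x 1 0`, `o` these lines
  -- become `X = 0` and `Y = 0`, as `chasles_affine` requires.
  set o : Fin 3 → R := p • x 1 1 - bracket (x 2 0) (x 2 1) (x 1 1) • x 1 0 with ho
  set D := bracket (x 2 0) (x 1 0) o with hD
  have hDpq : D = p * q := by
    simp only [hD, ho, hp, hq, bracket, Pi.sub_apply, Pi.smul_apply, smul_eq_mul]
    ring
  have uD : IsUnit D := hDpq ▸ up.mul uq
  set X : (Fin 3 → R) → R := fun w => bracket w (x 1 0) o with hX
  set Y : (Fin 3 → R) → R := fun w => bracket (x 2 0) w o with hY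
  set Z : (Fin 3 → R) → R := fun w => bracket (x 2 0) (x 1 0) w with hZ
  have Xeq : ∀ w, X w = p * bracket (x 1 0) (x 1 1) w := by
    intro w
    simp only [hX, ho, bracket, Pi.sub_apply, Pi.smul_apply, smul_eq_mul]
    ring
  have Yeq : ∀ w, Y w = q * bracket (x 2 0) (x 2 1) w := by
    intro w
    simp only [hY, ho, hp, hq, bracket, Pi.sub_apply, Pi.smul_apply, smul_eq_mul]
    ring
  -- `X`, `Y`, `Z` are the coordinates of `D • w` rather than of `w`; this produces the powers of
  -- `D` in `brk` and `cub`.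
  have cram : ∀ w, D • w = X w • x 2 0 + Y w • x 1 0 + Z w • o := fun w => bracket_cramer _ _ _ _
  have brk : ∀ u v w, bracket ![X u, Y u, Z u] ![X v, Y v, Z v] ![X w, Y w, Z w] =
      D ^ 2 * bracket u v w := by
    intro u v w
    apply uD.mul_right_cancel
    have h := bracket_comb (x 2 0) (x 1 0) o ![X u, Y u, Z u] ![X v, Y v, Z v] ![X w, Y w, Z w]
    simp only [Matrix.cons_val_zero, Matrix.cons_val_one, Matrix.cons_val] at h
    rw [← cram, ← cram, ← cram] at h
    rw [← h]
    simp [bracket]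
    ring
  set c' := cubicChange c (x 2 0) (x 1 0) o with hc'
  have cub : ∀ w, cubic c' ![X w, Y w, Z w] = D ^ 3 * cubic c w := by
    intro w
    rw [← cubic_smul, cram, cubic_comb]
  have zero20 : Y (x 2 0) = 0 ∧ Z (x 2 0) = 0 := by
    constructor <;> simp only [hY, hZ, bracket] <;> ring
  have zero10 : X (x 1 0) = 0 ∧ Z (x 1 0) = 0 := by
    constructor <;> simp only [hX, hZ, bracket] <;> ring
  have X1 : ∀ b, X (x 1 b) = 0 := by
    intro b
    rw [Xeq]
    fin_cases b
    · simp [bracket]; ring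
    · simp [bracket]; ring
    · simp [hrow 1]
  have Y2 : ∀ b, Y (x 2 b) = 0 := by
    intro b
    rw [Yeq]
    fin_cases b
    · simp [bracket]; ring
    · simp [bracket]; ring
    · simp [hrow 2]
  have uY1 : ∀ b, IsUnit (Y (x 1 b)) := fun b =>
    Yeq (x 1 b) ▸ uq.mul (hunit _ _ _ _ _ (by decide) (by decide))
  have uX2 : ∀ b, IsUnit (X (x 2 b)) := fun b =>
    Xeq (x 2 b) ▸ up.mul (hunit _ _ _ _ _ (by decide) (by decide))
  have uX0 : ∀ b, IsUnit (X (x 0 b)) := fun b =>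
    Xeq (x 0 b) ▸ up.mul (hunit _ _ _ _ _ (by decide) (by decide))
  have uY0 : ∀ b, IsUnit (Y (x 0 b)) := fun b =>
    Yeq (x 0 b) ▸ uq.mul (hunit _ _ _ _ _ (by decide) (by decide))
  choose y' hy' using fun b => (uY1 b).exists_right_inv
  choose x' hx' using fun b => (uX2 b).exists_right_inv
  have ediff : ∀ b b', Z (x 1 b) * y' b - Z (x 1 b') * y' b' =
      y' b * y' b' * (Z (x 1 b) * Y (x 1 b') - Z (x 1 b') * Y (x 1 b)) := by
    intro b b'
    linear_combination -(Z (x 1 b) * y' b) * hy' b' + (Z (x 1 b') * y' b') * hy' b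
  have ediff' : ∀ b b', Z (x 2 b) * x' b - Z (x 2 b') * x' b' =
      x' b * x' b' * (Z (x 2 b) * X (x 2 b') - Z (x 2 b') * X (x 2 b)) := by
    intro b b'
    linear_combination -(Z (x 2 b) * x' b) * hx' b' + (Z (x 2 b') * x' b') * hx' b
  have uy' : ∀ b, IsUnit (y' b) := fun b => IsUnit.of_mul_eq_one (Y (x 1 b))
    (by rw [mul_comm]; exact hy' b)
  have ux' : ∀ b, IsUnit (x' b) := fun b => IsUnit.of_mul_eq_one (X (x 2 b))
    (by rw [mul_comm]; exact hx' b)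
  have udiff : ∀ b b', b ≠ b' → IsUnit (Z (x 1 b) * y' b - Z (x 1 b') * y' b') := by
    intro b b' hbb
    rw [ediff]
    refine ((uy' b).mul (uy' b')).mul ?_
    have h := brk (x 1 b') (x 1 b) (x 2 0)
    rw [X1, X1, zero20.1, zero20.2] at h
    have u : IsUnit (D ^ 2 * bracket (x 1 b') (x 1 b) (x 2 0)) :=
      (uD.pow 2).mul (hunit _ _ _ _ _ (by decide) hbb.symm)
    rw [← h] at u
    refine isUnit_of_mul_isUnit_right (x := X (x 2 0)) ?_
    convert u using 1
    simp [bracket]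
    ring
  have udiff' : ∀ b b', b ≠ b' → IsUnit (Z (x 2 b) * x' b - Z (x 2 b') * x' b') := by
    intro b b' hbb
    rw [ediff']
    refine ((ux' b).mul (ux' b')).mul ?_
    have h := brk (x 2 b) (x 2 b') (x 1 0)
    rw [Y2, Y2, zero10.1, zero10.2] at h
    have u : IsUnit (D ^ 2 * bracket (x 2 b) (x 2 b') (x 1 0)) :=
      (uD.pow 2).mul (hunit _ _ _ _ _ (by decide) hbb)
    rw [← h] at u
    refine isUnit_of_mul_isUnit_right (x := Y (x 1 0)) ?_
    convert u using 1
    simp [bracket]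
    ring
  -- Collinearity of column `b`, solved for the last coordinate of its point in row 0.
  have Z0 : ∀ b, Z (x 0 b) = Z (x 1 b) * y' b * Y (x 0 b) + Z (x 2 b) * x' b * X (x 0 b) := by
    intro b
    have h := brk (x 0 b) (x 1 b) (x 2 b)
    rw [hcol, X1, Y2] at h
    simp [bracket] at h
    linear_combination -(x' b * y' b) * h -
      (Z (x 0 b) - Z (x 2 b) * x' b * X (x 0 b)) * hy' b -
      (y' b * Y (x 1 b) * Z (x 0 b) - Z (x 1 b) * y' b * Y (x 0 b)) * hx' b
  have h1 : ∀ b, cubic c' ![0, 1, Z (x 1 b) * y' b] = 0 := by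
    intro b
    refine cubic_eq_zero_of_smul c' (uY1 b) (v := ![X (x 1 b), Y (x 1 b), Z (x 1 b)]) ?_ ?_
    · ext i
      fin_cases i
      · simp [X1]
      · simp
      · simp
        linear_combination -Z (x 1 b) * hy' b
    · rw [cub, h0 _ _ (by simp), mul_zero]
  have h2 : ∀ b, cubic c' ![1, 0, Z (x 2 b) * x' b] = 0 := by
    intro b
    refine cubic_eq_zero_of_smul c' (uX2 b) (v := ![X (x 2 b), Y (x 2 b), Z (x 2 b)]) ?_ ?_
    · ext i
      fin_cases i
      · simp
      · simp [Y2]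
      · simp
        linear_combination -Z (x 2 b) * hx' b
    · rw [cub, h0 _ _ (by simp), mul_zero]
  have u12 : IsUnit (bracket (x 0 1) (x 0 2) (x 1 0)) := hunit _ _ _ _ _ (by decide) (by decide)
  obtain ⟨i12, hi12⟩ := u12.exists_right_inv
  have hlin : ∃ l m : R, x 0 0 = l • x 0 1 + m • x 0 2 := by
    refine ⟨i12 * bracket (x 0 0) (x 0 2) (x 1 0), i12 * bracket (x 0 1) (x 0 0) (x 1 0), ?_⟩
    have h := bracket_cramer (x 0 1) (x 0 2) (x 1 0) (x 0 0)
    have h3 : bracket (x 0 1) (x 0 2) (x 0 0) = 0 := by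
      rw [← hrow 0]
      simp only [bracket]
      ring
    rw [h3, zero_smul, add_zero] at h
    have h4 := congrArg (fun v => i12 • v) h
    simp only [smul_smul, smul_add] at h4
    rw [mul_comm i12 (bracket _ _ _), hi12, one_smul] at h4
    exact h4
  obtain ⟨l, m, hlm⟩ := hlin
  have h := chasles_affine c' (fun b => Z (x 1 b) * y' b) (fun b => Z (x 2 b) * x' b)
    (fun b => X (x 0 b)) (fun b => Y (x 0 b)) l m udiff udiff' (uX0 1) (uX0 2) (uY0 1) (uY0 2)
    h1 h2 (by rw [← Z0, cub, h0 _ _ (by simp), mul_zero])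
    (by rw [← Z0, cub, h0 _ _ (by simp), mul_zero])
    (by simp only [hX, hlm, bracket, Pi.add_apply, Pi.smul_apply, smul_eq_mul]; ring)
    (by simp only [hY, hlm, bracket, Pi.add_apply, Pi.smul_apply, smul_eq_mul]; ring)
    (by
      rw [← Z0, ← Z0, ← Z0]
      simp only [hZ, hlm, bracket, Pi.add_apply, Pi.smul_apply, smul_eq_mul]; ring)
  rw [← Z0, cub] at h
  exact (uD.pow 3).mul_right_eq_zero.1 h

end Chasles

/-! ### Zero sum triples in `ZMod n` -/

section ZeroSum

theorem intCast_zmod_ne {n : ℕ} {s t : ℤ} (hst : s ≠ t) (h1 : s - t < n) (h2 : t - s < n) :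
    (s : ZMod n) ≠ t := by
  intro h
  rw [ZMod.intCast_eq_intCast_iff_dvd_sub] at h
  obtain ⟨k, hk⟩ := h
  rcases lt_trichotomy k 0 with h0 | h0 | h0
  · nlinarith
  · subst h0
    apply hst
    linarith
  · nlinarith

theorem exists_intCast_zmod {n : ℕ} (hn : n ≠ 0) (k : ZMod n) :
    ∃ s : ℤ, (s : ZMod n) = k ∧ 2 * s ≤ n ∧ -(2 * s) ≤ n := by
  have : NeZero n := ⟨hn⟩
  refine ⟨k.valMinAbs, k.coe_valMinAbs, ?_⟩
  have := ZMod.natAbs_valMinAbs_le k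
  omega

/-- A property of residues that propagates along `3 × 3` arrays with zero row and column sums
holds everywhere as soon as it holds for nine well chosen consecutive residues. -/
theorem zmod_array_induction {n : ℕ} (hn : 10 ≤ n) (K : ZMod n → Prop)
    (hS : ∀ s : ℤ, -5 ≤ s → s ≤ 3 → K s)
    (hK : ∀ y : Fin 3 → Fin 3 → ZMod n, Function.Injective (fun z : Fin 3 × Fin 3 => y z.1 z.2) →
      (∀ a, y a 0 + y a 1 + y a 2 = 0) → (∀ b, y 0 b + y 1 b + y 2 b = 0) →
      (∀ a b, ¬ (a = 0 ∧ b = 0) → K (y a b)) → K (y 0 0)) (k : ZMod n) : K k := by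
  have step : ∀ (y : Fin 3 → Fin 3 → ℤ) (L : ℤ), (∀ a b, L ≤ y a b ∧ y a b < L + n) →
      Function.Injective (fun z : Fin 3 × Fin 3 => y z.1 z.2) →
      (∀ a, y a 0 + y a 1 + y a 2 = 0) → (∀ b, y 0 b + y 1 b + y 2 b = 0) →
      (∀ a b, ¬ (a = 0 ∧ b = 0) → K (y a b)) → K (y 0 0) := by
    intro y L hL hinj hr hc h
    refine hK (fun a b => (y a b : ZMod n)) ?_ ?_ ?_ h
    · intro z z' hz
      by_contra hne
      have h1 := hL z.1 z.2
      have h2 := hL z'.1 z'.2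
      exact intCast_zmod_ne (fun h => hne (hinj h)) (by linarith) (by linarith) hz
    · intro a
      exact_mod_cast congrArg (Int.cast : ℤ → ZMod n) (hr a)
    · intro b
      exact_mod_cast congrArg (Int.cast : ℤ → ZMod n) (hc b)
  have h4 : K ((4 : ℤ) : ZMod n) := by
    refine step ![![4, 0, -4], ![-1, -2, 3], ![-3, 2, 1]] (-4) ?_ ?_ ?_ ?_ ?_
    · intro a b
      fin_cases a <;> fin_cases b <;> simp <;> omega
    · decide
    · decide
    · decide
    · intro a b hab
      fin_cases a <;> fin_cases b <;> first | exact absurd ⟨rfl, rfl⟩ hab | skip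
      all_goals exact hS _ (by decide) (by decide)
  have hS' : ∀ s : ℤ, -5 ≤ s → s ≤ 4 → K s := by
    intro s h1 h2
    rcases eq_or_lt_of_le h2 with rfl | h
    · exact h4
    · exact hS s h1 (by omega)
  have h5 : K ((5 : ℤ) : ZMod n) := by
    -- The array for 5 contains both 5 and -5, which are distinct only for `n > 10`; for `n = 10`
    -- they coincide and nothing is left to prove.
    rcases eq_or_lt_of_le hn with h | h
    · have e : ((5 : ℤ) : ZMod n) = ((-5 : ℤ) : ZMod n) := by
        rw [ZMod.intCast_eq_intCast_iff_dvd_sub, ← h]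
        norm_num
      rw [e]
      exact hS _ (by norm_num) (by norm_num)
    · refine step ![![5, 0, -5], ![-1, -3, 4], ![-4, 3, 1]] (-5) ?_ ?_ ?_ ?_ ?_
      · intro a b
        fin_cases a <;> fin_cases b <;> simp <;> omega
      · decide
      · decide
      · decide
      · intro a b hab
        fin_cases a <;> fin_cases b <;> first | exact absurd ⟨rfl, rfl⟩ hab | skip
        all_goals exact hS' _ (by decide) (by decide)
  have main : ∀ N : ℕ, 5 ≤ N → 2 * N ≤ n → ∀ s : ℤ, -N ≤ s → s ≤ N → K s := by
    intro N h5N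
    induction N, h5N using Nat.le_induction with
    | base =>
      intro _ s h1 h2
      rcases eq_or_lt_of_le h2 with rfl | h
      · exact h5
      · exact hS' s h1 (by push_cast at h; omega)
    | succ N hN ih =>
      intro h2N s h1 h2
      have ih := ih (by omega)
      push_cast at h1 h2
      by_cases e1 : s = N + 1
      · subst e1
        -- All entries but the corner lie in `[-N, N]`. For `N = 4` the entry 2 would occur twice,
        -- so this family starts at `N = 5` and the values 4 and 5 need arrays of their own.
        refine step ![![N + 1, -1, -N], ![-2, 0, 2], ![1 - N, 1, N - 2]] (-N) ?_ ?_ ?_ ?_ ?_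
        · intro a b
          fin_cases a <;> fin_cases b <;> simp <;> omega
        · rintro ⟨a, b⟩ ⟨a', b'⟩ h
          fin_cases a <;> fin_cases b <;> fin_cases a' <;> fin_cases b' <;>
            first | rfl | (exfalso; simp at h <;> omega)
        · intro a
          fin_cases a <;> simp <;> ring
        · intro a
          fin_cases a <;> simp <;> ring
        · intro a b hab
          fin_cases a <;> fin_cases b <;> first | exact absurd ⟨rfl, rfl⟩ hab | skip
          all_goals
            refine ih _ ?_ ?_ <;> simp <;> omega
      by_cases e2 : s = -(N + 1)
      · subst e2
        refine step ![![-(N + 1), 1, N], ![2, 0, -2], ![N - 1, -1, 2 - N]] (-(N + 1)) ?_ ?_ ?_ ?_ ?_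
        · intro a b
          fin_cases a <;> fin_cases b <;> simp <;> omega
        · rintro ⟨a, b⟩ ⟨a', b'⟩ h
          fin_cases a <;> fin_cases b <;> fin_cases a' <;> fin_cases b' <;>
            first | rfl | (exfalso; simp at h <;> omega)
        · intro a
          fin_cases a <;> simp <;> ring
        · intro a
          fin_cases a <;> simp <;> ring
        · intro a b hab
          fin_cases a <;> fin_cases b <;> first | exact absurd ⟨rfl, rfl⟩ hab | skip
          all_goals
            refine ih _ ?_ ?_ <;> simp <;> omega
      · exact ih s (by omega) (by omega)
  obtain ⟨s, rfl, h1, h2⟩ := exists_intCast_zmod (by omega) k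
  exact main (n / 2) (by omega) (by omega) s (by omega) (by omega)

/-- A function on `ZMod n` whose sum over all zero sum triples vanishes is zero. -/
theorem eq_zero_of_zero_sum_triples {n : ℕ} (hn : 10 ≤ n) {F : Type*} [Field F] [CharZero F]
    (v : ZMod n → F) (hv : ∀ i j k : ZMod n, i ≠ j → i ≠ k → j ≠ k → i + j + k = 0 →
      v i + v j + v k = 0) (k : ZMod n) : v k = 0 := by
  have hw : ∀ a b c : ℤ, a + b + c = 0 → a ≠ b → a ≠ c → b ≠ c → a - b < n → b - a < n →
      a - c < n → c - a < n → b - c < n → c - b < n →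
      v (a : ZMod n) + v (b : ZMod n) + v (c : ZMod n) = 0 := by
    intro a b c h hab hac hbc h1 h2 h3 h4 h5 h6
    refine hv _ _ _ (intCast_zmod_ne hab h1 h2) (intCast_zmod_ne hac h3 h4)
      (intCast_zmod_ne hbc h5 h6) ?_
    exact_mod_cast congrArg (Int.cast : ℤ → ZMod n) h
  set w : ℤ → F := fun s => v (s : ZMod n) with hwdef
  change ∀ a b c : ℤ, _ → _ → _ → _ → _ → _ → _ → _ → _ → _ → w a + w b + w c = 0 at hw
  have hneg : ∀ m : ℤ, 0 < m → 2 * m < n → w (-m) = -w 0 - w m := by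
    intro m h1 h2
    linear_combination hw 0 m (-m) (by ring) (by omega) (by omega) (by omega) (by omega) (by omega)
      (by omega) (by omega) (by omega) (by omega)
  have t123 := hw 1 2 (-3) (by norm_num) (by omega) (by omega) (by omega) (by omega) (by omega)
      (by omega) (by omega) (by omega) (by omega)
  have t123' := hw (-1) (-2) 3 (by norm_num) (by omega) (by omega) (by omega) (by omega) (by omega)
      (by omega) (by omega) (by omega) (by omega)
  have n1 := hneg 1 (by norm_num) (by omega)
  have n2 := hneg 2 (by norm_num) (by omega)
  have n3 := hneg 3 (by norm_num) (by omega)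
  have n4 := hneg 4 (by norm_num) (by omega)
  -- The triples `(1, 2, -3)` and `(-1, -2, 3)` add up to three pairs `w m + w (-m) = -w 0`.
  have w0 : w 0 = 0 := by
    have : (3 : F) * w 0 = 0 := by
      linear_combination -t123 - t123' + n1 + n2 + n3
    simpa using this
  have t134 := hw 1 3 (-4) (by norm_num) (by omega) (by omega) (by omega) (by omega) (by omega)
      (by omega) (by omega) (by omega) (by omega)
  have t145 := hw 1 4 (-5) (by norm_num) (by omega) (by omega) (by omega) (by omega) (by omega)
      (by omega) (by omega) (by omega) (by omega)
  have t235 := hw 2 3 (-5) (by norm_num) (by omega) (by omega) (by omega) (by omega) (by omega)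
      (by omega) (by omega) (by omega) (by omega)
  -- The value at -5 cancels between two triples; this matters for `n = 10`, where `-5 = 5` and
  -- `hneg` is not available.
  have w2 : w 2 = 2 * w 1 := by
    linear_combination t235 - t145 - t134 + n4 - w0
  have main : ∀ N : ℕ, 2 * N < n → w N = N * w 1 := by
    intro N
    induction N with
    | zero => intro _; simpa using w0
    | succ N ih =>
      intro hN
      have ih := ih (by omega)
      rcases Nat.lt_or_ge 1 N with h | h
      · have e := hw 1 N (-(N + 1)) (by ring) (by omega) (by omega) (by omega) (by omega) (by omega)
          (by omega) (by omega) (by omega) (by omega)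
        have e' := hneg (N + 1) (by omega) (by omega)
        push_cast
        linear_combination -e + e' + ih - w0
      · interval_cases N
        · simp
        · simpa using w2
  have w1 : w 1 = 0 := by
    have hn0 : ((n : ℕ) : F) ≠ 0 := by
      have : n ≠ 0 := by omega
      exact_mod_cast this
    refine (mul_eq_zero.1 (?_ : ((n : ℕ) : F) * w 1 = 0)).resolve_left hn0
    -- So far `w` is linear with slope `w 1`; going once around `ℤ/n` now gives `n * w 1 = 0`. For
    -- `n = 2N` the identification is `-N = N`. For `n = 2N + 1` it is `-(N + 1) = N`, so the triple
    -- `(1, N, -(N + 1))` degenerates and `(2, N - 1, -(N + 1))` is used instead.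
    obtain ⟨N, hN | hN⟩ := Nat.even_or_odd' n
    · have e : w (-(N : ℤ)) = w N := by
        simp only [hwdef]
        congr 1
        rw [ZMod.intCast_eq_intCast_iff_dvd_sub]
        exact ⟨1, by rw [hN]; push_cast; ring⟩
      have e1 := hw 1 (N - 1) (-N) (by ring) (by omega) (by omega) (by omega) (by omega) (by omega)
          (by omega) (by omega) (by omega) (by omega)
      have e2 := hw (-1) (-(N - 1)) N (by ring) (by omega) (by omega) (by omega) (by omega)
          (by omega) (by omega) (by omega) (by omega) (by omega)
      have e3 := hneg (N - 1) (by omega) (by omega)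
      have e4 := main (N - 1) (by omega)
      rw [Nat.cast_sub (by omega), Nat.cast_sub (by omega)] at e4
      push_cast at e4
      rw [hN]
      push_cast
      linear_combination e1 - e2 + n1 + e3 - e - 2 * e4 - 2 * w0
    · have e : w (-((N : ℤ) + 1)) = w N := by
        simp only [hwdef]
        congr 1
        rw [ZMod.intCast_eq_intCast_iff_dvd_sub]
        exact ⟨1, by rw [hN]; push_cast; ring⟩
      have e1 := hw 2 (N - 1) (-(N + 1)) (by ring) (by omega) (by omega) (by omega) (by omega)
          (by omega) (by omega) (by omega) (by omega) (by omega)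
      have e3 := main N (by omega)
      have e4 := main (N - 1) (by omega)
      rw [Nat.cast_sub (by omega), Nat.cast_sub (by omega)] at e4
      push_cast at e4
      rw [hN]
      push_cast
      linear_combination e1 - e - w2 - e3 - e4
  have wpos : ∀ s : ℤ, 0 ≤ s → 2 * s < n → w s = 0 := by
    intro s h0 h1
    lift s to ℕ using h0
    rw [main s (by omega), w1, mul_zero]
  have wneg : ∀ s : ℤ, 0 < s → 2 * s < n → w (-s) = 0 := by
    intro s h0 h1
    rw [hneg s h0 h1, w0, wpos s h0.le h1, sub_zero, neg_zero]
  obtain ⟨s, rfl, h1, h2⟩ := exists_intCast_zmod (by omega) k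
  change w s = 0
  -- The residue `n / 2` is outside the range of `wpos` and `wneg`; a triple whose other two values
  -- are known settles it.
  rcases eq_or_lt_of_le h1 with e | h1
  · have e1 := hw (-1) (-(s - 1)) s (by ring) (by omega) (by omega) (by omega) (by omega)
      (by omega) (by omega) (by omega) (by omega) (by omega)
    rwa [wneg 1 (by norm_num) (by omega), wneg (s - 1) (by omega) (by omega), zero_add,
      zero_add] at e1
  rcases eq_or_lt_of_le h2 with e | h2
  · have e1 := hw 1 (-s - 1) s (by ring) (by omega) (by omega) (by omega) (by omega)
      (by omega) (by omega) (by omega) (by omega) (by omega)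
    rwa [w1, wpos (-s - 1) (by omega) (by omega), zero_add, zero_add] at e1
  rcases le_or_gt 0 s with h | h
  · exact wpos s h h1
  · simpa using wneg (-s) (by omega) (by omega)

theorem exists_notMem_list_zmod {n : ℕ} [NeZero n] (l : List (ZMod n)) (hl : l.length < n) :
    ∃ x : ZMod n, x ∉ l := by
  by_contra! h
  have h1 : (Finset.univ : Finset (ZMod n)) ⊆ l.toFinset := fun x _ => by simpa using h x
  have h2 := Finset.card_le_card h1
  rw [Finset.card_univ, ZMod.card] at h2
  exact absurd (h2.trans l.toFinset_card_le) (by omega)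

/-- With `J` the representative of `j` of least absolute value, one of `(2, 3, -5)`, `(1, 3, -4)`,
`(1, 4, -5)`, `(1, 2, -3)` avoids `0` and `±J`, according to whether `|J|` is 1, 2, 3 or larger. -/
theorem exists_disjoint_zero_sum_triple_of_zero {n : ℕ} (hn : 10 ≤ n) {j : ZMod n} (hj : j ≠ 0) :
    ∃ a b c : ZMod n, a ≠ b ∧ a ≠ c ∧ b ≠ c ∧ a + b + c = 0 ∧
      ∀ z, z = 0 ∨ z = j ∨ z = -j → z ≠ a ∧ z ≠ b ∧ z ≠ c := by
  obtain ⟨J, rfl, h1, h2⟩ := exists_intCast_zmod (by omega) j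
  have hJ : J ≠ 0 := by
    rintro rfl
    simp at hj
  have key : ∀ a b c : ℤ, a + b + c = 0 → 0 < a → a < b → b ≤ 4 → J ≠ a → J ≠ b → J ≠ c →
      -J ≠ a → -J ≠ b → -J ≠ c → J - c < n → -J - c < n → -5 ≤ c → ∃ a b c : ZMod n, a ≠ b ∧ a ≠ c ∧
        b ≠ c ∧ a + b + c = 0 ∧
      ∀ z, z = 0 ∨ z = (J : ZMod n) ∨ z = -(J : ZMod n) → z ≠ a ∧ z ≠ b ∧ z ≠ c := by
    intro a b c h ha hab hb4 h1a h1b h1c h2a h2b h2c h3 h4 h5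
    refine ⟨a, b, c, intCast_zmod_ne (by omega) (by omega) (by omega),
      intCast_zmod_ne (by omega) (by omega) (by omega),
      intCast_zmod_ne (by omega) (by omega) (by omega),
      by exact_mod_cast congrArg (Int.cast : ℤ → ZMod n) h, ?_⟩
    have hz : ∀ s : ℤ, s = 0 ∨ s = J ∨ s = -J → (s : ZMod n) ≠ a ∧ (s : ZMod n) ≠ b ∧
        (s : ZMod n) ≠ c := by
      intro s hs
      exact ⟨intCast_zmod_ne (by omega) (by omega) (by omega),
        intCast_zmod_ne (by omega) (by omega) (by omega),
        intCast_zmod_ne (by omega) (by omega) (by omega)⟩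
    rintro z (rfl | rfl | rfl)
    · simpa using hz 0 (by simp)
    · simpa using hz J (by simp)
    · simpa using hz (-J) (by simp)
  by_cases c1 : J = 1 ∨ J = -1
  · exact key 2 3 (-5) (by omega) (by omega) (by omega) (by omega) (by omega) (by omega)
      (by omega) (by omega) (by omega) (by omega) (by omega) (by omega) (by norm_num)
  by_cases c2 : J = 2 ∨ J = -2
  · exact key 1 3 (-4) (by omega) (by omega) (by omega) (by omega) (by omega) (by omega)
      (by omega) (by omega) (by omega) (by omega) (by omega) (by omega) (by norm_num)
  by_cases c3 : J = 3 ∨ J = -3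
  · exact key 1 4 (-5) (by omega) (by omega) (by omega) (by omega) (by omega) (by omega)
      (by omega) (by omega) (by omega) (by omega) (by omega) (by omega) (by norm_num)
  · exact key 1 2 (-3) (by omega) (by omega) (by omega) (by omega) (by omega) (by omega)
      (by omega) (by omega) (by omega) (by omega) (by omega) (by omega) (by norm_num)

/-- If no index is zero, then `{0, t, -t}` works for some `t` in `{1, 2, 3, 4}`: the three indices
can block at most three of these values. -/
theorem exists_disjoint_zero_sum_triple {n : ℕ} (hn : 10 ≤ n) {i j k : ZMod n} (hij : i ≠ j)
    (hik : i ≠ k) (hjk : j ≠ k) (h : i + j + k = 0) :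
    ∃ a b c : ZMod n, a ≠ b ∧ a ≠ c ∧ b ≠ c ∧ a + b + c = 0 ∧
      ∀ z, z = i ∨ z = j ∨ z = k → z ≠ a ∧ z ≠ b ∧ z ≠ c := by
  by_cases hi : i = 0
  · obtain ⟨a, b, c, hab, hac, hbc, hs, hz⟩ :=
      exists_disjoint_zero_sum_triple_of_zero hn (j := j) (fun h => hij (hi.trans h.symm))
    refine ⟨a, b, c, hab, hac, hbc, hs, fun z hz' => hz z ?_⟩
    have : k = -j := by linear_combination h - hi
    rw [← hi, ← this]
    exact hz'
  by_cases hj : j = 0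
  · obtain ⟨a, b, c, hab, hac, hbc, hs, hz⟩ :=
      exists_disjoint_zero_sum_triple_of_zero hn (j := i) hi
    refine ⟨a, b, c, hab, hac, hbc, hs, fun z hz' => hz z ?_⟩
    have : k = -i := by linear_combination h - hj
    rw [← hj, ← this]
    tauto
  by_cases hk : k = 0
  · obtain ⟨a, b, c, hab, hac, hbc, hs, hz⟩ :=
      exists_disjoint_zero_sum_triple_of_zero hn (j := i) hi
    refine ⟨a, b, c, hab, hac, hbc, hs, fun z hz' => hz z ?_⟩
    have : j = -i := by linear_combination h - hk
    rw [← hk, ← this]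
    tauto
  obtain ⟨I, rfl, hI1, hI2⟩ := exists_intCast_zmod (by omega) i
  obtain ⟨J, rfl, hJ1, hJ2⟩ := exists_intCast_zmod (by omega) j
  obtain ⟨K, rfl, hK1, hK2⟩ := exists_intCast_zmod (by omega) k
  have hI0 : I ≠ 0 := by rintro rfl; simp at hi
  have hJ0 : J ≠ 0 := by rintro rfl; simp at hj
  have hK0 : K ≠ 0 := by rintro rfl; simp at hk
  have : ∃ t : ℤ, 0 < t ∧ t ≤ 4 ∧ (∀ s, s = I ∨ s = J ∨ s = K → s ≠ t ∧ s ≠ -t) := by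
    by_contra! hc
    have e : ∀ t : ℤ, 0 < t → t ≤ 4 → I = t ∨ I = -t ∨ J = t ∨ J = -t ∨ K = t ∨ K = -t := by
      intro t h0 h4
      obtain ⟨s, hs, h⟩ := hc t h0 h4
      by_cases hst : s = t
      · rcases hs with rfl | rfl | rfl <;> tauto
      · have := h hst
        rcases hs with rfl | rfl | rfl <;> tauto
    have e1 := e 1 (by norm_num) (by norm_num)
    have e2 := e 2 (by norm_num) (by norm_num)
    have e3 := e 3 (by norm_num) (by norm_num)
    have e4 := e 4 (by norm_num) (by norm_num)
    omega
  obtain ⟨t, ht0, ht4, ht⟩ := this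
  refine ⟨((0 : ℤ) : ZMod n), (t : ZMod n), ((-t : ℤ) : ZMod n),
    intCast_zmod_ne (by omega) (by omega) (by omega),
    intCast_zmod_ne (by omega) (by omega) (by omega),
    intCast_zmod_ne (by omega) (by omega) (by omega), by simp, ?_⟩
  have hz : ∀ s : ℤ, s = I ∨ s = J ∨ s = K → (s : ZMod n) ≠ (0 : ℤ) ∧ (s : ZMod n) ≠ t ∧
      (s : ZMod n) ≠ (-t : ℤ) := by
    intro s hs
    have := ht s hs
    exact ⟨intCast_zmod_ne (by omega) (by omega) (by omega),
      intCast_zmod_ne (by omega) (by omega) (by omega),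
      intCast_zmod_ne (by omega) (by omega) (by omega)⟩
  rintro z (rfl | rfl | rfl)
  · exact hz I (by simp)
  · exact hz J (by simp)
  · exact hz K (by simp)

end ZeroSum

/-! ### Cubics through cyclic arrangements of points -/

section Arrangement

/-- A family of vectors indexed by `ZMod n`, thought of as points of the projective plane over a
local ring, for which the collinear triples are exactly the zero sum triples. -/
def CyclicArrangement {n : ℕ} {R : Type*} [CommRing R] (x : ZMod n → Fin 3 → R) : Prop :=
  ∀ i j k : ZMod n, i ≠ j → i ≠ k → j ≠ k →
    (i + j + k = 0 → bracket (x i) (x j) (x k) = 0) ∧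
    (i + j + k ≠ 0 → IsUnit (bracket (x i) (x j) (x k)))

/-- Each array of the induction is a Cayley–Bacharach configuration. The ring is general because the
result is needed twice: over the field for the existence of the cubic, and over the dual numbers for
tangency. -/
theorem CyclicArrangement.cubic_eq_zero {n : ℕ} (hn : 10 ≤ n) {R : Type*} [CommRing R]
    {x : ZMod n → Fin 3 → R} (hx : CyclicArrangement x) (c : Fin 10 → R)
    (hS : ∀ s : ℤ, -5 ≤ s → s ≤ 3 → cubic c (x s) = 0) (k : ZMod n) : cubic c (x k) = 0 := by
  refine zmod_array_induction hn (fun k => cubic c (x k) = 0) hS ?_ k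
  intro y hinj hr hc h
  have hne : ∀ a b a' b', ¬ (a = a' ∧ b = b') → y a b ≠ y a' b' := by
    intro a b a' b' h1 h2
    have := @hinj (a, b) (a', b') h2
    exact h1 (by simpa using this)
  refine chasles c (fun a b => x (y a b)) ?_ ?_ ?_ h
  · intro a
    exact (hx _ _ _ (hne _ _ _ _ (by simp)) (hne _ _ _ _ (by simp)) (hne _ _ _ _ (by simp))).1
      (hr a)
  · intro b
    exact (hx _ _ _ (hne _ _ _ _ (by simp)) (hne _ _ _ _ (by simp)) (hne _ _ _ _ (by simp))).1
      (hc b)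
  · intro a a' b b' b'' ha hb
    refine (hx _ _ _ (hne _ _ _ _ (by simp [hb])) (hne _ _ _ _ (by simp [ha]))
      (hne _ _ _ _ (by simp [ha]))).2 ?_
    intro hs
    -- Two entries of a row determine the third index of a zero sum triple, namely the third entry
    -- of that row. An entry of another row is different from it, so the bracket is a unit.
    have hthird : ∃ d, y a b + y a b' + y a d = 0 := by
      have hra := hr a
      fin_cases b <;> fin_cases b' <;> first | exact absurd rfl hb | skip
      · exact ⟨2, hra⟩
      · exact ⟨1, by simp only [← hra]; simp; ring⟩
      · exact ⟨2, by simp only [← hra]; simp; ring⟩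
      · exact ⟨0, by simp only [← hra]; simp; ring⟩
      · exact ⟨1, by simp only [← hra]; simp; ring⟩
      · exact ⟨0, by simp only [← hra]; simp; ring⟩
    obtain ⟨d, hd⟩ := hthird
    exact hne a d a' b'' (by simp [ha]) (add_left_cancel (hd.trans hs.symm))

variable {n : ℕ} {F : Type*} [Field F] {p : ZMod n → Fin 3 → F}

theorem CyclicArrangement.ne_zero (hp : CyclicArrangement p) {i j k : ZMod n} (hij : i ≠ j)
    (hik : i ≠ k) (hjk : j ≠ k) (h : i + j + k ≠ 0) : bracket (p i) (p j) (p k) ≠ 0 :=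
  ((hp i j k hij hik hjk).2 h).ne_zero

theorem CyclicArrangement.bracket_ne_zero (hp : CyclicArrangement p) {i j k m : ZMod n}
    (hij : i ≠ j) (h : i + j + k = 0) (hi : m ≠ i) (hj : m ≠ j) (hk : m ≠ k) :
    bracket (p i) (p j) (p m) ≠ 0 :=
  hp.ne_zero hij hi.symm hj.symm fun h' => hk (add_left_cancel (h'.trans h.symm))

theorem CyclicArrangement.exists_comb (hn : 10 ≤ n) (hp : CyclicArrangement p) {i j k : ZMod n}
    (hij : i ≠ j) (hik : i ≠ k) (hjk : j ≠ k) (h : i + j + k = 0) :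
    ∃ a b : F, a ≠ 0 ∧ b ≠ 0 ∧ p k = a • p i + b • p j := by
  have : NeZero n := ⟨by omega⟩
  obtain ⟨m, hm⟩ := exists_notMem_list_zmod [i, j, k] (by simp; omega)
  simp only [List.mem_cons, List.not_mem_nil, or_false, not_or] at hm
  obtain ⟨hmi, hmj, hmk⟩ := hm
  have h0 : bracket (p i) (p j) (p m) ≠ 0 := hp.bracket_ne_zero hij h hmi hmj hmk
  have h1 : bracket (p k) (p j) (p m) ≠ 0 :=
    hp.bracket_ne_zero hjk.symm (by rw [← h]; ring : k + j + i = 0) hmk hmj hmi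
  have h2 : bracket (p i) (p k) (p m) ≠ 0 :=
    hp.bracket_ne_zero hik (by rw [← h]; ring : i + k + j = 0) hmi hmk hmj
  have e := bracket_cramer (p i) (p j) (p m) (p k)
  rw [(hp i j k hij hik hjk).1 h, zero_smul, add_zero] at e
  refine ⟨_, _, mul_ne_zero (inv_ne_zero h0) h1, mul_ne_zero (inv_ne_zero h0) h2, ?_⟩
  rw [mul_smul, mul_smul, ← smul_add, ← e, smul_smul, inv_mul_cancel₀ h0, one_smul]

theorem CyclicArrangement.exists_cubic (hn : 10 ≤ n) (hp : CyclicArrangement p) :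
    ∃ c : Fin 10 → F, c ≠ 0 ∧ ∀ k, cubic c (p k) = 0 := by
  let f : (Fin 10 → F) →ₗ[F] (Fin 9 → F) :=
    { toFun := fun c s => cubic c (p ((s : ℤ) - 5 : ℤ))
      map_add' := by
        intro c d
        ext s
        simp only [cubic, Pi.add_apply]
        ring
      map_smul' := by
        intro r c
        ext s
        simp only [cubic, Pi.smul_apply, smul_eq_mul, RingHom.id_apply]
        ring }
  have hker : LinearMap.ker f ≠ ⊥ := LinearMap.ker_ne_bot_of_finrank_lt (by simp)
  obtain ⟨c, hc, hc0⟩ := Submodule.exists_mem_ne_zero_of_ne_bot hker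
  refine ⟨c, hc0, hp.cubic_eq_zero hn c ?_⟩
  intro s h1 h2
  have := congrFun (LinearMap.mem_ker.1 hc) ⟨(s + 5).toNat, by omega⟩
  simp only [f, LinearMap.coe_mk, AddHom.coe_mk] at this
  rw [show (((s + 5).toNat : ℕ) : ℤ) - 5 = s by omega] at this
  exact this

theorem eq_zero_of_cubic_eq_zero [CharZero F] {c : Fin 10 → F} (h : ∀ v, cubic c v = 0) :
    c = 0 := by
  have h1 := h ![1, 0, 0]
  have h2 := h ![0, 1, 0]
  have h3 := h ![0, 0, 1]
  have h4 := h ![1, 1, 0]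
  have h5 := h ![1, -1, 0]
  have h6 := h ![1, 0, 1]
  have h7 := h ![1, 0, -1]
  have h8 := h ![0, 1, 1]
  have h9 := h ![0, 1, -1]
  have h10 := h ![1, 1, 1]
  simp [cubic] at h1 h2 h3 h4 h5 h6 h7 h8 h9 h10
  simp only [h1, h2, h3, zero_add, zero_mul, add_zero] at h4 h5 h6 h7 h8 h9 h10
  have t : ∀ x y : F, x + y = 0 → -x + y = 0 → x = 0 ∧ y = 0 := by
    intro x y hx hy
    have hy0 : (2 : F) * y = 0 := by linear_combination hx + hy
    have hy0 : y = 0 := by simpa using hy0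
    exact ⟨by simpa [hy0] using hx, hy0⟩
  obtain ⟨e3, e4⟩ := t _ _ h4 h5
  obtain ⟨e5, e6⟩ := t _ _ h6 h7
  obtain ⟨e7, e8⟩ := t _ _ h8 h9
  simp only [e3, e4, e5, e6, e7, e8, zero_add] at h10
  ext i
  fin_cases i <;> simpa

theorem eq_zero_of_linear_form_eq_zero {a : Fin 3 → F} {u v w : Fin 3 → F}
    (h : bracket u v w ≠ 0) (hu : a 0 * u 0 + a 1 * u 1 + a 2 * u 2 = 0)
    (hv : a 0 * v 0 + a 1 * v 1 + a 2 * v 2 = 0) (hw : a 0 * w 0 + a 1 * w 1 + a 2 * w 2 = 0) :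
    a = 0 := by
  have h0 : a 0 = 0 := by
    apply mul_left_cancel₀ h
    simp only [bracket]
    linear_combination (v 1 * w 2 - v 2 * w 1) * hu - (u 1 * w 2 - u 2 * w 1) * hv +
      (u 1 * v 2 - u 2 * v 1) * hw
  have h1 : a 1 = 0 := by
    apply mul_left_cancel₀ h
    simp only [bracket]
    linear_combination -(v 0 * w 2 - v 2 * w 0) * hu + (u 0 * w 2 - u 2 * w 0) * hv -
      (u 0 * v 2 - u 2 * v 0) * hw
  have h2 : a 2 = 0 := by
    apply mul_left_cancel₀ h
    simp only [bracket]
    linear_combination (v 0 * w 1 - v 1 * w 0) * hu - (u 0 * w 1 - u 1 * w 0) * hv +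
      (u 0 * v 1 - u 1 * v 0) * hw
  ext t
  fin_cases t <;> assumption

theorem bracket_coordinates_ne_zero {e₁ e₂ e₃ u v w : Fin 3 → F} (he : bracket e₁ e₂ e₃ ≠ 0)
    (h : bracket u v w ≠ 0) :
    bracket ![bracket u e₂ e₃, bracket e₁ u e₃, bracket e₁ e₂ u]
      ![bracket v e₂ e₃, bracket e₁ v e₃, bracket e₁ e₂ v]
      ![bracket w e₂ e₃, bracket e₁ w e₃, bracket e₁ e₂ w] ≠ 0 := by
  intro h0
  have hdet := bracket_comb e₁ e₂ e₃ ![bracket u e₂ e₃, bracket e₁ u e₃, bracket e₁ e₂ u]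
      ![bracket v e₂ e₃, bracket e₁ v e₃, bracket e₁ e₂ v]
      ![bracket w e₂ e₃, bracket e₁ w e₃, bracket e₁ e₂ w]
  simp only [Matrix.cons_val_zero, Matrix.cons_val_one, Matrix.cons_val] at hdet
  rw [← bracket_cramer, ← bracket_cramer, ← bracket_cramer, h0, zero_mul] at hdet
  refine mul_ne_zero (pow_ne_zero 3 he) h (Eq.trans ?_ hdet)
  generalize bracket e₁ e₂ e₃ = D
  simp only [bracket, Pi.smul_apply, smul_eq_mul]
  ring

/-- A cubic form that vanishes on the lines `⟨e₁, e₃⟩` and `⟨e₂, e₃⟩`, and at three non-collinear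
points off these lines, is zero. -/
theorem eq_zero_of_two_lines [CharZero F] {c : Fin 10 → F} {e₁ e₂ e₃ u v w : Fin 3 → F}
    (he : bracket e₁ e₂ e₃ ≠ 0) (h1 : ∀ x y : F, cubic c (x • e₁ + y • e₃) = 0)
    (h2 : ∀ x y : F, cubic c (x • e₂ + y • e₃) = 0) (huvw : bracket u v w ≠ 0)
    (hz : ∀ m, m = u ∨ m = v ∨ m = w →
      cubic c m = 0 ∧ bracket m e₂ e₃ ≠ 0 ∧ bracket e₁ m e₃ ≠ 0) : c = 0 := by
  have z1 : cubic c e₁ = 0 := by simpa using h1 1 0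
  have z2 : cubic c e₂ = 0 := by simpa using h2 1 0
  have z3 : cubic c e₃ = 0 := by simpa using h2 0 1
  have t : ∀ x y : F, x + y = 0 → -x + y = 0 → x = 0 ∧ y = 0 := by
    intro x y hx hy
    have hy0 : (2 : F) * y = 0 := by linear_combination hx + hy
    have hy0 : y = 0 := by simpa using hy0
    exact ⟨by simpa [hy0] using hx, hy0⟩
  have t13 : cubicPolar c e₁ e₃ = 0 ∧ cubicPolar c e₃ e₁ = 0 := by
    have e1 := h1 1 1
    have e2 := h1 1 (-1)
    rw [cubic_comb_two, z1, z3] at e1 e2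
    exact t _ _ (by linear_combination e1) (by linear_combination e2)
  have t23 : cubicPolar c e₂ e₃ = 0 ∧ cubicPolar c e₃ e₂ = 0 := by
    have e1 := h2 1 1
    have e2 := h2 1 (-1)
    rw [cubic_comb_two, z2, z3] at e1 e2
    exact t _ _ (by linear_combination e1) (by linear_combination e2)
  -- In coordinates for `e₁, e₂, e₃` the two lines are the zero sets of the second and the first
  -- coordinate, so the cubic is their product times a linear form. Three non-collinear zeros off
  -- the lines kill that form.
  have cub : ∀ m, bracket e₁ e₂ e₃ ^ 3 * cubic c m =
      bracket m e₂ e₃ * bracket e₁ m e₃ * (cubicPolar c e₁ e₂ * bracket m e₂ e₃ +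
        cubicPolar c e₂ e₁ * bracket e₁ m e₃ +
        cubicPolarization c e₁ e₂ e₃ * bracket e₁ e₂ m) := by
    intro m
    rw [← cubic_smul, bracket_cramer, cubic_comb, cubicChange, z1, z2, z3, t13.1, t13.2, t23.1,
      t23.2]
    generalize bracket m e₂ e₃ = x, bracket e₁ m e₃ = y, bracket e₁ e₂ m = z
    simp [cubic]
    ring
  have hlin : ∀ m, m = u ∨ m = v ∨ m = w → cubicPolar c e₁ e₂ * bracket m e₂ e₃ +
        cubicPolar c e₂ e₁ * bracket e₁ m e₃ +
        cubicPolarization c e₁ e₂ e₃ * bracket e₁ e₂ m = 0 := by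
    intro m hm
    obtain ⟨h0, hx, hy⟩ := hz m hm
    have := cub m
    rw [h0, mul_zero] at this
    exact (mul_eq_zero.1 this.symm).resolve_left (mul_ne_zero hx hy)
  have hg := eq_zero_of_linear_form_eq_zero
    (a := ![cubicPolar c e₁ e₂, cubicPolar c e₂ e₁, cubicPolarization c e₁ e₂ e₃])
    (bracket_coordinates_ne_zero he huvw) (hlin u (by simp)) (hlin v (by simp)) (hlin w (by simp))
  have g0 : cubicPolar c e₁ e₂ = 0 := congrFun hg 0
  have g1 : cubicPolar c e₂ e₁ = 0 := congrFun hg 1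
  have g2 : cubicPolarization c e₁ e₂ e₃ = 0 := congrFun hg 2
  refine eq_zero_of_cubic_eq_zero fun m => ?_
  apply mul_left_cancel₀ (pow_ne_zero 3 he)
  rw [cub, g0, g1, g2]
  ring

/-- The cubic through a cyclic arrangement contains none of the lines of the arrangement. -/
theorem CyclicArrangement.cubicPolar_ne_zero [CharZero F] (hn : 10 ≤ n) (hp : CyclicArrangement p)
    {c : Fin 10 → F} (hc : c ≠ 0) (hf : ∀ k, cubic c (p k) = 0) {i j k : ZMod n} (hij : i ≠ j)
    (hik : i ≠ k) (hjk : j ≠ k) (h : i + j + k = 0) : cubicPolar c (p i) (p j) ≠ 0 := by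
  intro h0
  apply hc
  have : NeZero n := ⟨by omega⟩
  -- On this line the cubic is a binary form with zeros at three distinct points; the assumed
  -- tangency makes it vanish identically.
  have hL : ∀ x y : F, cubic c (x • p i + y • p j) = 0 := by
    obtain ⟨a, b, ha, hb, hab⟩ := hp.exists_comb hn hij hik hjk h
    have e := hf k
    rw [hab, cubic_comb_two, hf, hf, h0] at e
    have h1 : cubicPolar c (p j) (p i) = 0 := by
      simpa [ha, hb] using e
    intro x y
    rw [cubic_comb_two, hf, hf, h0, h1]
    ring
  obtain ⟨a, b, d, hab, had, hbd, hs, hz⟩ := exists_disjoint_zero_sum_triple hn hij hik hjk h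
  obtain ⟨hia, hib, hid⟩ := hz i (by simp)
  obtain ⟨hja, hjb, hjd⟩ := hz j (by simp)
  obtain ⟨hka, hkb, hkd⟩ := hz k (by simp)
  set u := bracket (p i) (p j) (p a) with hu
  set w := bracket (p i) (p j) (p b) with hw
  have hu0 : u ≠ 0 := hp.bracket_ne_zero hij h hia.symm hja.symm hka.symm
  have hw0 : w ≠ 0 := hp.bracket_ne_zero hij h hib.symm hjb.symm hkb.symm
  have hd0 : bracket (p i) (p j) (p d) ≠ 0 :=
    hp.bracket_ne_zero hij h hid.symm hjd.symm hkd.symm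
  have habi : bracket (p a) (p b) (p i) ≠ 0 := hp.bracket_ne_zero hab hs hia hib hid
  -- The intersection of the line through `p i`, `p j` with the line through `p a`, `p b`.
  set o : Fin 3 → F := u • p b - w • p a with ho
  have ho' : o = bracket (p a) (p b) (p j) • p i - bracket (p a) (p b) (p i) • p j := by
    ext t
    fin_cases t <;> simp [ho, hu, hw, bracket] <;> ring
  have hfo : ∀ x y : F, cubic c (x • p i + y • o) = 0 := by
    intro x y
    rw [ho', smul_sub, smul_smul, smul_smul, sub_eq_add_neg, ← neg_smul, ← add_assoc, ← add_smul]
    exact hL _ _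
  -- The second line carries four zeros `p a`, `p b`, `p d`, `o`, so it also lies in the cubic. The
  -- points `p d` and `o` differ because `p d` is off the first line.
  have hM : ∀ x y : F, cubic c (x • p a + y • p b) = 0 := by
    obtain ⟨α, β, hα, hβ, hαβ⟩ := hp.exists_comb hn hab had hbd hs
    have e := hf d
    rw [hαβ, cubic_comb_two, hf, hf] at e
    have e1 : α * cubicPolar c (p a) (p b) + β * cubicPolar c (p b) (p a) = 0 := by
      apply mul_left_cancel₀ (mul_ne_zero hα hβ)
      linear_combination e
    have e' := hfo 0 1
    rw [zero_smul, zero_add, one_smul, ho, sub_eq_neg_add, ← neg_smul, cubic_comb_two, hf, hf] at e'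
    have e2 : -w * cubicPolar c (p a) (p b) + u * cubicPolar c (p b) (p a) = 0 := by
      apply mul_left_cancel₀ (mul_ne_zero (neg_ne_zero.2 hw0) hu0)
      linear_combination e'
    have e3 : bracket (p i) (p j) (p d) = α * u + β * w := by
      rw [hαβ]
      simp only [hu, hw, bracket, Pi.add_apply, Pi.smul_apply, smul_eq_mul]
      ring
    have q1 : cubicPolar c (p a) (p b) = 0 := by
      apply mul_left_cancel₀ hd0
      rw [e3]
      linear_combination u * e1 - β * e2
    have q2 : cubicPolar c (p b) (p a) = 0 := by
      apply mul_left_cancel₀ hd0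
      rw [e3]
      linear_combination w * e1 + α * e2
    intro x y
    rw [cubic_comb_two, hf, hf, q1, q2]
    ring
  have hMo : ∀ x y : F, cubic c (x • p a + y • o) = 0 := by
    intro x y
    have : x • p a + y • o = (x - y * w) • p a + (y * u) • p b := by
      rw [ho]
      module
    rw [this]
    exact hM _ _
  set D := bracket (p i) (p a) o with hD
  have hX : ∀ m, bracket (p m) (p a) o = u * bracket (p a) (p b) (p m) := by
    intro m
    simp only [ho, bracket, Pi.sub_apply, Pi.smul_apply, smul_eq_mul]
    ring
  have hY : ∀ m, bracket (p i) (p m) o =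
      bracket (p a) (p b) (p i) * bracket (p i) (p j) (p m) := by
    intro m
    simp only [ho', bracket, Pi.sub_apply, Pi.smul_apply, smul_eq_mul]
    ring
  have hD0 : D ≠ 0 := by
    rw [hD, hX]
    exact mul_ne_zero hu0 habi
  -- Three non-collinear points off both lines. The last choice avoids nine residues, which `n ≥ 10`
  -- allows.
  obtain ⟨m₁, h1⟩ := exists_notMem_list_zmod [i, j, k, a, b, d] (by simp; omega)
  obtain ⟨m₂, h2⟩ := exists_notMem_list_zmod [i, j, k, a, b, d, m₁] (by simp; omega)
  obtain ⟨m₃, h3⟩ := exists_notMem_list_zmod [i, j, k, a, b, d, m₁, m₂, -m₁ - m₂]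
    (by simp; omega)
  simp only [List.mem_cons, List.not_mem_nil, or_false, not_or] at h1 h2 h3
  obtain ⟨hi1, hj1, hk1, ha1, hb1, hd1⟩ := h1
  obtain ⟨hi2, hj2, hk2, ha2, hb2, hd2, h12⟩ := h2
  obtain ⟨hi3, hj3, hk3, ha3, hb3, hd3, h13, h23, h123⟩ := h3
  have hm : bracket (p m₁) (p m₂) (p m₃) ≠ 0 :=
    hp.ne_zero (Ne.symm h12) (Ne.symm h13) (Ne.symm h23) fun e =>
      h123 (by linear_combination e)
  refine eq_zero_of_two_lines hD0 hfo hMo hm ?_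
  have hoff : ∀ m, m ≠ i → m ≠ j → m ≠ k → m ≠ a → m ≠ b → m ≠ d →
      cubic c (p m) = 0 ∧ bracket (p m) (p a) o ≠ 0 ∧ bracket (p i) (p m) o ≠ 0 := by
    intro m hmi hmj hmk hma hmb hmd
    refine ⟨hf m, ?_, ?_⟩
    · rw [hX]
      exact mul_ne_zero hu0 (hp.bracket_ne_zero hab hs hma hmb hmd)
    · rw [hY]
      exact mul_ne_zero habi (hp.bracket_ne_zero hij h hmi hmj hmk)
  rintro _ (rfl | rfl | rfl)
  · exact hoff _ hi1 hj1 hk1 ha1 hb1 hd1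
  · exact hoff _ hi2 hj2 hk2 ha2 hb2 hd2
  · exact hoff _ hi3 hj3 hk3 ha3 hb3 hd3

end Arrangement

/-! ### First order deformations of cyclic arrangements -/

section Deformation

variable {n : ℕ} {F : Type*} [Field F] {p : ZMod n → Fin 3 → F}

/-- The derivative of the bracket at `(u, v, w)` in the direction `(u', v', w')`. -/
def bracketDeriv (u v w u' v' w' : Fin 3 → F) : F :=
  bracket u' v w + bracket u v' w + bracket u v w'

/-- The family of vectors over the dual numbers with value `u` and derivative `u'`. -/
def dualVec (u u' : Fin 3 → F) : Fin 3 → DualNumber F :=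
  fun t => TrivSqZeroExt.inl (u t) + TrivSqZeroExt.inr (u' t)

theorem fst_bracket_dualVec (u v w u' v' w' : Fin 3 → F) :
    (bracket (dualVec u u') (dualVec v v') (dualVec w w')).fst = bracket u v w := by
  simp [bracket, dualVec]

theorem snd_bracket_dualVec (u v w u' v' w' : Fin 3 → F) :
    (bracket (dualVec u u') (dualVec v v') (dualVec w w')).snd = bracketDeriv u v w u' v' w' := by
  simp [bracket, bracketDeriv, dualVec]
  ring

theorem cubic_dualVec (c : Fin 10 → F) (u u' : Fin 3 → F) :
    cubic (fun t => (TrivSqZeroExt.inl (c t) : DualNumber F)) (dualVec u u') =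
      TrivSqZeroExt.inl (cubic c u) + TrivSqZeroExt.inr (cubicPolar c u u') := by
  ext
  · simp [cubic, dualVec]
  · simp [cubic, cubicPolar, cubicGrad, dualVec, pow_succ]
    ring

/-- `p + ε q` is a cyclic arrangement over the dual numbers, and the `ε`-part of the value of `c`
there is the derivative of `c` along `q`. The propagation from nine points therefore applies to
tangency. -/
theorem CyclicArrangement.cubicPolar_eq_zero (hn : 10 ≤ n) (hp : CyclicArrangement p)
    {c : Fin 10 → F} (hf : ∀ k, cubic c (p k) = 0) {q : ZMod n → Fin 3 → F}
    (hq : ∀ i j k : ZMod n, i ≠ j → i ≠ k → j ≠ k → i + j + k = 0 →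
      bracketDeriv (p i) (p j) (p k) (q i) (q j) (q k) = 0)
    (hS : ∀ s : ℤ, -5 ≤ s → s ≤ 3 → cubicPolar c (p s) (q s) = 0) (k : ZMod n) :
    cubicPolar c (p k) (q k) = 0 := by
  have hx : CyclicArrangement fun k => dualVec (p k) (q k) := by
    intro i j k hij hik hjk
    constructor
    · intro h
      ext
      · rw [fst_bracket_dualVec, (hp i j k hij hik hjk).1 h, TrivSqZeroExt.fst_zero]
      · rw [snd_bracket_dualVec, hq i j k hij hik hjk h, TrivSqZeroExt.snd_zero]
    · intro h
      rw [TrivSqZeroExt.isUnit_iff_isUnit_fst, fst_bracket_dualVec]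
      exact (hp i j k hij hik hjk).2 h
  have h := hx.cubic_eq_zero hn (fun t => TrivSqZeroExt.inl (c t)) (fun s h1 h2 => by
    rw [cubic_dualVec, hf, hS s h1 h2]
    simp) k
  rw [cubic_dualVec, hf] at h
  simpa using congrArg TrivSqZeroExt.snd h

/-- The cross product. -/
def cross (u v : Fin 3 → F) : Fin 3 → F :=
  ![u 1 * v 2 - u 2 * v 1, u 2 * v 0 - u 0 * v 2, u 0 * v 1 - u 1 * v 0]

theorem exists_smul_of_cross_eq_zero {u v : Fin 3 → F} (hu : u ≠ 0) (h : cross u v = 0) :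
    ∃ r : F, v = r • u := by
  obtain ⟨a, ha⟩ := Function.ne_iff.1 hu
  have h0 := congrFun h 0
  have h1 := congrFun h 1
  have h2 := congrFun h 2
  simp [cross] at h0 h1 h2 ha
  refine ⟨v a / u a, ?_⟩
  ext t
  rw [Pi.smul_apply, smul_eq_mul, div_mul_eq_mul_div, eq_div_iff ha]
  have key : ∀ a t : Fin 3, v t * u a = v a * u t := by
    have h01 : v 1 * u 0 = v 0 * u 1 := by linear_combination h2
    have h02 : v 2 * u 0 = v 0 * u 2 := by linear_combination -h1
    have h12 : v 2 * u 1 = v 1 * u 2 := by linear_combination h0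
    intro a t
    fin_cases a <;> fin_cases t <;> first
      | rfl
      | exact h01
      | exact h02
      | exact h12
      | exact h01.symm
      | exact h02.symm
      | exact h12.symm
  exact key a t

/-- The rigidity statement: a deformation that stays on the fixed cubic moves no point projectively,
because its velocities along the curve sum to zero on zero sum triples. -/
theorem CyclicArrangement.exists_smul_of_cubicPolar_eq_zero [CharZero F] (hn : 10 ≤ n)
    (hp : CyclicArrangement p) {c : Fin 10 → F} (hc : c ≠ 0) (hf : ∀ k, cubic c (p k) = 0)
    {q : ZMod n → Fin 3 → F}
    (hq : ∀ i j k : ZMod n, i ≠ j → i ≠ k → j ≠ k → i + j + k = 0 →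
      bracketDeriv (p i) (p j) (p k) (q i) (q j) (q k) = 0)
    (hS : ∀ s : ℤ, -5 ≤ s → s ≤ 3 → cubicPolar c (p s) (q s) = 0) (k : ZMod n) :
    ∃ r : F, q k = r • p k := by
  have : NeZero n := ⟨by omega⟩
  have hpol := hp.cubicPolar_eq_zero hn hf hq hS
  have hgrad : ∀ i, p i ≠ 0 ∧ cubicGrad c (p i) ≠ 0 := by
    intro i
    -- Every index belongs to a zero sum triple of distinct indices. If the first choice has `2j =
    -- -i`, it is replaced by `j + 1`, which the two extra excluded values keep admissible.
    have two : ∃ j, j ≠ i ∧ -i - j ≠ i ∧ -i - j ≠ j := by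
      obtain ⟨j, hj⟩ := exists_notMem_list_zmod [i, -(2 * i), i - 1, -(2 * i) - 1]
        (by simp; omega)
      simp only [List.mem_cons, List.not_mem_nil, or_false, not_or] at hj
      obtain ⟨j1, j2, j3, j4⟩ := hj
      by_cases h : -i - j = j
      · refine ⟨j + 1, fun e => j3 (by linear_combination e),
          fun e => j4 (by linear_combination -e), fun e => ?_⟩
        have h2 : ((2 : ℤ) : ZMod n) ≠ ((0 : ℤ) : ZMod n) :=
          intCast_zmod_ne (by norm_num) (by omega) (by omega)
        apply h2
        push_cast
        linear_combination h - e
      · exact ⟨j, j1, fun e => j2 (by linear_combination -e), h⟩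
    obtain ⟨j, hji, hki, hkj⟩ := two
    have h := hp.cubicPolar_ne_zero hn hc hf hji.symm hki.symm hkj.symm (by ring)
    constructor
    · intro h0
      rw [h0] at h
      simp [cubicPolar, cubicGrad] at h
    · intro h0
      rw [cubicPolar, h0] at h
      simp at h
  -- By tangency and Euler's identity, `q i` and `p i` are both orthogonal to the gradient, which is
  -- nonzero; so their cross product is a multiple of it. The factor `v i` is the velocity of `p i`
  -- along the cubic.
  have hv : ∀ i, ∃ v : F, cross (p i) (q i) = v • cubicGrad c (p i) := by
    intro i
    refine exists_smul_of_cross_eq_zero (hgrad i).2 ?_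
    have e1 := hpol i
    have e2 := cubicPolar_self c (p i)
    rw [hf, mul_zero] at e2
    rw [cubicPolar] at e1 e2
    generalize cubicGrad c (p i) = g at e1 e2
    ext t
    fin_cases t <;> simp [cross]
    · linear_combination p i 0 * e1 - q i 0 * e2
    · linear_combination p i 1 * e1 - q i 1 * e2
    · linear_combination p i 2 * e1 - q i 2 * e2
  choose v hv using hv
  have hv' : ∀ i w, bracket w (p i) (q i) = v i * cubicPolar c (p i) w := by
    intro i w
    have h0 := congrFun (hv i) 0
    have h1 := congrFun (hv i) 1
    have h2 := congrFun (hv i) 2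
    simp [cross] at h0 h1 h2
    simp only [bracket, cubicPolar]
    linear_combination w 0 * h0 + w 1 * h1 + w 2 * h2
  -- With `p k = a p i + b p j`, the vanishing of the cubic at `p k` gives `hB`. The derivative of
  -- the collinearity condition, multiplied by `b`, then becomes `a * b * A * (v i + v j + v k)`.
  have hvsum : ∀ i j k : ZMod n, i ≠ j → i ≠ k → j ≠ k → i + j + k = 0 →
      v i + v j + v k = 0 := by
    intro i j k hij hik hjk h
    obtain ⟨a, b, ha, hb, hab⟩ := hp.exists_comb hn hij hik hjk h
    have hA := hp.cubicPolar_ne_zero hn hc hf hij hik hjk h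
    set A := cubicPolar c (p i) (p j)
    have hB : a * A + b * cubicPolar c (p j) (p i) = 0 := by
      have e := hf k
      rw [hab, cubic_comb_two, hf, hf] at e
      apply mul_left_cancel₀ (mul_ne_zero ha hb)
      linear_combination e
    have e0 := hq i j k hij hik hjk h
    have ei := hv' i (p j)
    have ej := hv' j (p i)
    have ek := hv' k (p i)
    have hk : cubicPolar c (p k) (p i) = 2 * a * b * A + b ^ 2 * cubicPolar c (p j) (p i) := by
      have := hf i
      have e : cubicPolar c (p k) (p i) = 3 * a ^ 2 * cubic c (p i) + 2 * a * b * A +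
          b ^ 2 * cubicPolar c (p j) (p i) := by
        rw [hab]
        simp [A, cubic, cubicPolar, cubicGrad]
        ring
      rw [e, this]
      ring
    apply mul_left_cancel₀ (mul_ne_zero (mul_ne_zero ha hb) hA)
    have e1 : b * bracketDeriv (p i) (p j) (p k) (q i) (q j) (q k) =
        a * b * bracket (p j) (p i) (q i) - b ^ 2 * bracket (p i) (p j) (q j) +
          bracket (p i) (p k) (q k) := by
      rw [hab]
      simp only [bracketDeriv, bracket, Pi.add_apply, Pi.smul_apply, smul_eq_mul]
      ring
    rw [e0, ei, ej, ek, hk] at e1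
    linear_combination -e1 + (b * v j - b * v k) * hB
  have hv0 := eq_zero_of_zero_sum_triples hn v hvsum
  refine exists_smul_of_cross_eq_zero (hgrad k).1 ?_
  rw [hv, hv0, zero_smul]

/-- The first order deformations `q` of an arrangement `p` that fix four points `p (j a)` and
the coordinates `p k (b k)`. -/
def deformationSpace (p : ZMod n → Fin 3 → F) (b : ZMod n → Fin 3) (j : Fin 4 → ZMod n) :
    Submodule F (ZMod n → Fin 3 → F) where
  carrier := {q | (∀ i j k : ZMod n, i ≠ j → i ≠ k → j ≠ k → i + j + k = 0 →
    bracketDeriv (p i) (p j) (p k) (q i) (q j) (q k) = 0) ∧ (∀ k, q k (b k) = 0) ∧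
    ∀ a, q (j a) = 0}
  add_mem' := by
    rintro q r ⟨hq, hqb, hqj⟩ ⟨hr, hrb, hrj⟩
    refine ⟨fun i j k hij hik hjk h => ?_, fun k => by simp [hqb, hrb], fun a => by simp [hqj, hrj]⟩
    have h1 := hq i j k hij hik hjk h
    have h2 := hr i j k hij hik hjk h
    simp only [bracketDeriv, bracket, Pi.add_apply] at h1 h2 ⊢
    linear_combination h1 + h2
  zero_mem' := by
    refine ⟨fun i j k _ _ _ _ => by simp [bracketDeriv, bracket], fun k => rfl, fun a => rfl⟩
  smul_mem' := by
    rintro r q ⟨hq, hqb, hqj⟩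
    refine ⟨fun i j k hij hik hjk h => ?_, fun k => by simp [hqb], fun a => by simp [hqj]⟩
    have h1 := hq i j k hij hik hjk h
    simp only [bracketDeriv, bracket, Pi.smul_apply, smul_eq_mul] at h1 ⊢
    linear_combination r * h1

theorem bracketDeriv_mulVec (A : Matrix (Fin 3) (Fin 3) F) (u v w : Fin 3 → F) :
    bracketDeriv u v w (A.mulVec u) (A.mulVec v) (A.mulVec w) = A.trace * bracket u v w := by
  simp [bracketDeriv, bracket, Matrix.mulVec, dotProduct, Fin.sum_univ_three, Matrix.trace]
  ring

/-- Four eigenvectors in general position: the first three make `A` diagonal, and the fourth makes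
the eigenvalues equal. -/
theorem eq_scalar_of_frame {A : Matrix (Fin 3) (Fin 3) F}
    (h : ∀ a, ∃ r : F, A.mulVec (MatroidRealization.canonicalVec F a) =
      r • MatroidRealization.canonicalVec F a) : ∃ r : F, A = r • (1 : Matrix _ _ F) := by
  choose r hr using h
  have e0 := hr 0
  have e1 := hr 1
  have e2 := hr 2
  have e3 := hr 3
  rw [funext_iff, Fin.forall_fin_succ, Fin.forall_fin_two] at e0 e1 e2 e3
  simp [MatroidRealization.canonicalVec, Matrix.mulVec, dotProduct, Fin.sum_univ_three]
    at e0 e1 e2 e3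
  obtain ⟨a0, a1, a2⟩ := e0
  obtain ⟨b0, b1, b2⟩ := e1
  obtain ⟨c0, c1, c2⟩ := e2
  obtain ⟨d0, d1, d2⟩ := e3
  refine ⟨r 3, ?_⟩
  ext s t
  fin_cases s <;> fin_cases t <;> simp [*] <;> simp_all

/-- The nine dimensions of matrices account for the infinitesimal projective transformations and
cancel the nine conditions at the points `-5, …, 3`. The one remaining dimension comes from the
scalar matrices, which act trivially. -/
theorem CyclicArrangement.rank_deformationSpace_le [CharZero F] (hn : 10 ≤ n)
    (hp : CyclicArrangement p) {b : ZMod n → Fin 3} (hb : ∀ k, p k (b k) ≠ 0) {j : Fin 4 → ZMod n}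
    (hj : ∀ a, ∃ r : F, r ≠ 0 ∧ p (j a) = r • MatroidRealization.canonicalVec F a) :
    Module.rank F (deformationSpace p b j) ≤ 1 := by
  have : NeZero n := ⟨by omega⟩
  obtain ⟨c, hc, hf⟩ := hp.exists_cubic hn
  let f : deformationSpace p b j × Matrix (Fin 3) (Fin 3) F →ₗ[F] (Fin 9 → F) :=
    { toFun := fun x s => cubicPolar c (p ((s : ℤ) - 5 : ℤ))
        ((x.1 : ZMod n → Fin 3 → F) ((s : ℤ) - 5 : ℤ) + x.2.mulVec (p ((s : ℤ) - 5 : ℤ)))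
      map_add' := by
        intro x y
        ext s
        simp only [cubicPolar, Prod.fst_add, Prod.snd_add, Submodule.coe_add, Pi.add_apply,
          Matrix.add_mulVec]
        ring
      map_smul' := by
        intro r x
        ext s
        simp only [cubicPolar, Prod.smul_fst, Prod.smul_snd, Submodule.coe_smul, Pi.add_apply,
          Pi.smul_apply, Matrix.smul_mulVec, smul_eq_mul, RingHom.id_apply]
        ring }
  have hker : LinearMap.ker f ≤ Submodule.span F {(0, 1)} := by
    rintro ⟨⟨q, hq, hqb, hqj⟩, A⟩ hx
    have hS : ∀ s : ℤ, -5 ≤ s → s ≤ 3 →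
        cubicPolar c (p s) ((fun k => q k + A.mulVec (p k)) s) = 0 := by
      intro s h1 h2
      have := congrFun (LinearMap.mem_ker.1 hx) ⟨(s + 5).toNat, by omega⟩
      simp only [f, LinearMap.coe_mk, AddHom.coe_mk] at this
      rw [show (((s + 5).toNat : ℕ) : ℤ) - 5 = s by omega] at this
      exact this
    have key := hp.exists_smul_of_cubicPolar_eq_zero hn hc hf (q := fun k => q k + A.mulVec (p k))
      (by
        intro i j k hij hik hjk h
        have h1 := hq i j k hij hik hjk h
        have h2 := bracketDeriv_mulVec A (p i) (p j) (p k)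
        rw [(hp i j k hij hik hjk).1 h, mul_zero] at h2
        simp only [bracketDeriv, bracket, Pi.add_apply] at h1 h2 ⊢
        linear_combination h1 + h2) hS
    obtain ⟨t, rfl⟩ := eq_scalar_of_frame (A := A) (by
      intro a
      obtain ⟨r, hr⟩ := key (j a)
      obtain ⟨s, hs, hsp⟩ := hj a
      simp only [hqj, zero_add, hsp, Matrix.mulVec_smul] at hr
      refine ⟨r, ?_⟩
      rw [smul_comm] at hr
      exact smul_right_injective _ hs hr)
    -- `q k` is a multiple of `p k`, with vanishing coordinate `b k` where `p k` does not vanish.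
    have hq0 : q = 0 := by
      ext k i
      obtain ⟨r, hr⟩ := key k
      simp only [Matrix.smul_mulVec, Matrix.one_mulVec] at hr
      have h1 := congrFun hr (b k)
      simp only [Pi.add_apply, hqb, zero_add, Pi.smul_apply, smul_eq_mul] at h1
      have h2 := mul_right_cancel₀ (hb k) h1
      have h3 := congrFun hr i
      simp only [Pi.add_apply, Pi.smul_apply, h2] at h3
      simpa using h3
    subst hq0
    rw [Submodule.mem_span_singleton]
    exact ⟨t, by ext <;> simp⟩
  have h1 : Module.finrank F (LinearMap.ker f) ≤ 1 :=
    (Submodule.finrank_mono hker).trans ((finrank_span_le_card _).trans (by simp))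
  have h2 := f.finrank_range_add_finrank_ker
  have h3 : Module.finrank F (LinearMap.range f) ≤ 9 := by
    simpa using Submodule.finrank_le (LinearMap.range f)
  rw [Module.finrank_prod, Module.finrank_matrix] at h2
  simp at h2
  rw [← Module.finrank_eq_rank]
  exact_mod_cast (by omega : Module.finrank F (deformationSpace p b j) ≤ 1)

end Deformation

/-! ### Tangent vectors of a local ring with values in dual numbers -/

section DualCotangent

universe u
variable {R K : Type u} [CommRing R] [IsLocalRing R] [Field K]

open IsLocalRing

theorem mem_maximalIdeal_iff_of_surjective {f : R →+* K} (hf : Function.Surjective f) (r : R) :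
    r ∈ maximalIdeal R ↔ f r = 0 := by
  rw [← eq_maximalIdeal (RingHom.ker_isMaximal_of_surjective f hf), RingHom.mem_ker]

/-- The tangent space of a local ring `R` with residue field `K ⊆ R` has dimension at most that
of a space `T`, if homomorphisms from `R` to the dual numbers are determined by their derivatives
at a family of elements `x`, and these derivatives belong to `T`. -/
theorem rank_dual_cotangentSpace_le {ev : R →+* K} {cst : K →+* R} (hev : ∀ c, ev (cst c) = c)
    {ι ι' : Type u} (x : ι → ι' → R) (T : Submodule K (ι → ι' → K))
    (hx : ∀ Θ : R →+* DualNumber K, (∀ r, (Θ r).fst = ev r) →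
      (∀ c, Θ (cst c) = TrivSqZeroExt.inl c) → (∀ i j, (Θ (x i j)).snd = 0) → ∀ r, (Θ r).snd = 0)
    (hT : ∀ Θ : R →+* DualNumber K, (∀ r, (Θ r).fst = ev r) →
      (∀ c, Θ (cst c) = TrivSqZeroExt.inl c) → (fun i j => (Θ (x i j)).snd) ∈ T) :
    Module.rank (ResidueField R) (Module.Dual (ResidueField R) (CotangentSpace R)) ≤
      Module.rank K T := by
  have hsurj : Function.Surjective ev := fun c => ⟨cst c, hev c⟩
  have hmem := mem_maximalIdeal_iff_of_surjective hsurj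
  have : IsLocalHom ev := ⟨fun r hr => by
    by_contra h
    exact hr.ne_zero ((hmem r).1 h)⟩
  let res : ResidueField R →+* K := ResidueField.lift ev
  have hres : ∀ r, res (residue R r) = ev r := fun r => ResidueField.lift_residue_apply ev r
  let δ : Module.Dual (ResidueField R) (CotangentSpace R) → maximalIdeal R → K :=
    fun φ m => res (φ ((maximalIdeal R).toCotangent m))
  have δadd : ∀ φ m m', δ φ (m + m') = δ φ m + δ φ m' := by
    intro φ m m'
    simp only [δ, map_add]
  have δsmul : ∀ φ r m, δ φ (r • m) = ev r * δ φ m := by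
    intro φ r m
    simp only [δ]
    rw [map_smul, algebra_compatible_smul (ResidueField R) r, map_smul, smul_eq_mul, map_mul]
    rw [← hres]
    rfl
  -- The derivation attached to a functional on `𝔪 / 𝔪²`: subtract the constant term, then apply the
  -- functional. `ev + ε D` is then a ring homomorphism to the dual numbers.
  let D : Module.Dual (ResidueField R) (CotangentSpace R) → R → K := fun φ r =>
    δ φ ⟨r - cst (ev r), (hmem _).2 (by rw [map_sub, hev, sub_self])⟩
  have Dadd : ∀ φ r s, D φ (r + s) = D φ r + D φ s := by
    intro φ r s
    simp only [D, ← δadd]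
    congr 1
    ext
    simp only [Submodule.coe_add, map_add]
    ring
  have Dmul : ∀ φ r s, D φ (r * s) = ev r * D φ s + ev s * D φ r := by
    intro φ r s
    simp only [D]
    have h : ∀ m, δ φ (cst (ev s) • m) = ev s * δ φ m := by
      intro m
      rw [δsmul, hev]
    rw [← h, ← δsmul, ← δadd]
    congr 1
    ext
    simp only [Submodule.coe_add, Submodule.coe_smul, map_mul, smul_eq_mul]
    ring
  have Dcst : ∀ φ c, D φ (cst c) = 0 := by
    intro φ c
    have : (⟨cst c - cst (ev (cst c)), (hmem _).2 (by rw [hev, sub_self, map_zero])⟩ :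
        maximalIdeal R) = 0 := by
      ext
      simp [hev]
    simp only [D, this, δ, map_zero]
  let Θ : Module.Dual (ResidueField R) (CotangentSpace R) → R →+* DualNumber K := fun φ =>
    { toFun := fun r => TrivSqZeroExt.inl (ev r) + TrivSqZeroExt.inr (D φ r)
      map_one' := by
        have := Dcst φ 1
        rw [map_one] at this
        rw [this]
        simp
      map_zero' := by
        have := Dcst φ 0
        rw [map_zero] at this
        rw [this]
        simp
      map_mul' := by
        intro r s
        ext
        · simp
        · simp [Dmul]
          ring
      map_add' := by
        intro r s
        ext
        · simp
        · simp [Dadd] }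
  have Θfst : ∀ φ r, (Θ φ r).fst = ev r := by
    intro φ r
    simp [Θ]
  have Θsnd : ∀ φ r, (Θ φ r).snd = D φ r := by
    intro φ r
    simp [Θ]
  have Θcst : ∀ φ c, Θ φ (cst c) = TrivSqZeroExt.inl c := by
    intro φ c
    ext
    · rw [Θfst, hev, TrivSqZeroExt.fst_inl]
    · rw [Θsnd, Dcst, TrivSqZeroExt.snd_inl]
  let F : Module.Dual (ResidueField R) (CotangentSpace R) →+ T :=
    { toFun := fun φ => ⟨fun i j => (Θ φ (x i j)).snd, hT _ (Θfst φ) (Θcst φ)⟩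
      map_zero' := by
        ext i j
        simp [Θsnd, D, δ]
      map_add' := by
        intro φ ψ
        ext i j
        simp [Θsnd, D, δ] }
  -- The two spaces live over different fields, the residue field and `K`, so ranks are compared
  -- through an injective map that is semilinear along `res`.
  refine rank_le_of_surjective_injective res F ?_ ?_ ?_
  · intro c
    exact ⟨residue R (cst c), by rw [hres, hev]⟩
  · rw [injective_iff_map_eq_zero]
    intro φ hφ
    have h0 := hx (Θ φ) (Θfst φ) (Θcst φ) fun i j =>
      congrFun (congrFun (congrArg Subtype.val hφ) i) j
    ext m
    obtain ⟨m, rfl⟩ := (maximalIdeal R).toCotangent_surjective m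
    have h1 := h0 m
    rw [Θsnd] at h1
    have h2 : (⟨(m : R) - cst (ev m), (hmem _).2 (by rw [map_sub, hev, sub_self])⟩ :
        maximalIdeal R) = m := by
      ext
      simp [(hmem _).1 m.2]
    simp only [D, h2, δ] at h1
    simpa using h1
  · intro r φ
    ext i j
    simp [F, Θsnd, D, δ]

end DualCotangent

/-! ### Affine coordinates on the local rings of the moduli space -/

namespace MatroidRealization

theorem minor_eq_bracket {E R : Type*} [CommRing R] (c : E → Fin 3 → R) (i₁ i₂ i₃ : E) :
    minor c i₁ i₂ i₃ = bracket (c i₁) (c i₂) (c i₃) := by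
  rw [minor, Matrix.det_fin_three, bracket]
  simp
  ring

theorem map_bracket {R S : Type*} [CommRing R] [CommRing S] (f : R →+* S) (u v w : Fin 3 → R) :
    f (bracket u v w) = bracket (fun a => f (u a)) (fun a => f (v a)) (fun a => f (w a)) := by
  simp only [bracket, map_add, map_sub, map_mul]

section AffineCoordinates

universe u
variable {E : Type u} {K : Type u} [Field K] (p : E → ℙ K (Fin 3 → K))

theorem exists_pivot (v : ℙ K (Fin 3 → K)) : ∃ a, v.rep a ≠ 0 :=
  Function.ne_iff.1 v.rep_nonzero

/-- A nonzero homogeneous coordinate of the point `p e`. -/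
def pivot (e : E) : Fin 3 := (exists_pivot (p e)).choose

theorem rep_pivot_ne_zero (e : E) : (p e).rep (pivot p e) ≠ 0 := (exists_pivot (p e)).choose_spec

/-- The homogeneous coordinates of `p e`, normalized at the pivot. -/
def affineVec (e : E) : Fin 3 → K := ((p e).rep (pivot p e))⁻¹ • (p e).rep

theorem affineVec_pivot (e : E) : affineVec p e (pivot p e) = 1 :=
  inv_mul_cancel₀ (rep_pivot_ne_zero p e)

/-- The monomial of multidegree `d` in the pivots. -/
def pivotMonomial (d : E →₀ ℕ) : CoordRing E K :=
  d.prod fun e m => MvPolynomial.X (e, pivot p e) ^ m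

theorem pivotMonomial_add (d d' : E →₀ ℕ) :
    pivotMonomial p (d + d') = pivotMonomial p d * pivotMonomial p d' :=
  Finsupp.prod_add_index' (fun _ => pow_zero _) fun _ _ _ => pow_add _ _ _

theorem pivotMonomial_single (e : E) :
    pivotMonomial p (Finsupp.single e 1) = MvPolynomial.X (e, pivot p e) := by
  rw [pivotMonomial, Finsupp.prod_single_index (by exact pow_zero _), pow_one]

theorem pivotMonomial_zero : pivotMonomial p 0 = 1 := Finsupp.prod_zero_index

theorem evalAt_pivotMonomial_ne_zero (d : E →₀ ℕ) : evalAt p (pivotMonomial p d) ≠ 0 := by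
  rw [pivotMonomial, Finsupp.prod, map_prod, Finset.prod_ne_zero_iff]
  intro e _
  rw [map_pow]
  exact pow_ne_zero _ (by simpa [evalAt] using rep_pivot_ne_zero p e)

theorem isUnit_algebraMap_of_evalAt_ne_zero {f : CoordRing E K} (h : evalAt p f ≠ 0) :
    IsUnit (algebraMap (CoordRing E K)
      (Localization (RingHom.ker (evalAt p)).primeCompl) f) :=
  IsLocalization.map_units _ (⟨f, h⟩ : (RingHom.ker (evalAt p)).primeCompl)

variable [DecidableEq E]

/-- Evaluation of germs at the point `p`. -/
def evalLocal : AmbientLocalRing p →+* K :=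
  (IsLocalization.lift (M := (RingHom.ker (evalAt p)).primeCompl)
    (S := Localization (RingHom.ker (evalAt p)).primeCompl) (g := evalAt p)
    fun y => isUnit_iff_ne_zero.2 y.2).comp
    (algebraMap (AmbientLocalRing p) (Localization (RingHom.ker (evalAt p)).primeCompl))

theorem evalLocal_mul (z : AmbientLocalRing p) (f g : CoordRing E K)
    (h : z.val * algebraMap (CoordRing E K) _ f = algebraMap (CoordRing E K) _ g) :
    evalLocal p z * evalAt p f = evalAt p g := by
  have h1 := congrArg (IsLocalization.lift (M := (RingHom.ker (evalAt p)).primeCompl)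
    (S := Localization (RingHom.ker (evalAt p)).primeCompl) (g := evalAt p)
    fun y => isUnit_iff_ne_zero.2 y.2) h
  rw [map_mul, IsLocalization.lift_eq, IsLocalization.lift_eq] at h1
  exact h1

theorem val_mk_mul (c : HomogeneousLocalization.NumDenSameDeg (multigrading E K)
    (RingHom.ker (evalAt p)).primeCompl) :
    (HomogeneousLocalization.mk c).val * algebraMap (CoordRing E K) _ (c.den : CoordRing E K) =
      algebraMap (CoordRing E K) _ (c.num : CoordRing E K) := by
  rw [HomogeneousLocalization.val_mk, Localization.mk_eq_mk']
  exact IsLocalization.mk'_spec _ _ (⟨c.den, c.den_mem⟩ : (RingHom.ker (evalAt p)).primeCompl)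

theorem X_mem_multigrading (e : E) (a : Fin 3) :
    (MvPolynomial.X (e, a) : CoordRing E K) ∈ multigrading E K (Finsupp.single e 1) :=
  MvPolynomial.isWeightedHomogeneous_X K (fun x : E × Fin 3 => (Finsupp.single x.1 1 : E →₀ ℕ)) _

theorem C_mem_multigrading (r : K) :
    (MvPolynomial.C r : CoordRing E K) ∈ multigrading E K 0 :=
  MvPolynomial.isWeightedHomogeneous_C _ r

/-- The affine coordinates near the point `p`. -/
def affineCoord (e : E) (a : Fin 3) : AmbientLocalRing p :=
  HomogeneousLocalization.mk ⟨Finsupp.single e 1, ⟨MvPolynomial.X (e, a), X_mem_multigrading e a⟩,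
    ⟨MvPolynomial.X (e, pivot p e), X_mem_multigrading e _⟩, by
      change evalAt p _ ≠ 0
      simpa [evalAt] using rep_pivot_ne_zero p e⟩

theorem val_affineCoord_mul (e : E) (a : Fin 3) : (affineCoord p e a).val *
    algebraMap (CoordRing E K) _ (MvPolynomial.X (e, pivot p e)) =
      algebraMap (CoordRing E K) _ (MvPolynomial.X (e, a)) :=
  val_mk_mul p _

/-- The constants in the local ring. -/
def constLocal : K →+* AmbientLocalRing p :=
  (HomogeneousLocalization.fromZeroRingHom (multigrading E K) _).comp
    (algebraMap K (multigrading E K 0))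

theorem val_constLocal (r : K) :
    (constLocal p r).val = algebraMap (CoordRing E K) _ (MvPolynomial.C r) := by
  rw [← mul_one (constLocal p r).val, ← map_one (algebraMap (CoordRing E K) _)]
  exact val_mk_mul p _

/-- Dehomogenization. -/
def dehom : CoordRing E K →+* AmbientLocalRing p :=
  MvPolynomial.eval₂Hom (constLocal p) fun x => affineCoord p x.1 x.2

theorem pivotMonomial_mem_multigrading (d : E →₀ ℕ) :
    pivotMonomial p d ∈ multigrading E K d := by
  induction d using Finsupp.induction_linear with
  | zero =>
    rw [pivotMonomial_zero]
    exact MvPolynomial.isWeightedHomogeneous_one K _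
  | add d d' h h' =>
    rw [pivotMonomial_add]
    exact MvPolynomial.IsWeightedHomogeneous.mul h h'
  | single e m =>
    rw [pivotMonomial, Finsupp.prod_single_index (by exact pow_zero _)]
    have := MvPolynomial.IsWeightedHomogeneous.pow (X_mem_multigrading (K := K) e (pivot p e)) m
    rwa [Finsupp.smul_single, smul_eq_mul, mul_one] at this

theorem val_dehom_monomial (m : E × Fin 3 →₀ ℕ) (r : K) : ∃ d,
    MvPolynomial.monomial m r ∈ multigrading E K d ∧
    (dehom p (MvPolynomial.monomial m r)).val * algebraMap (CoordRing E K) _ (pivotMonomial p d) =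
      algebraMap (CoordRing E K) _ (MvPolynomial.monomial m r) := by
  refine MvPolynomial.induction_on_monomial (motive := fun f => ∃ d, f ∈ multigrading E K d ∧
    (dehom p f).val * algebraMap (CoordRing E K) _ (pivotMonomial p d) =
      algebraMap (CoordRing E K) _ f) ?_ ?_ m r
  · intro a
    refine ⟨0, C_mem_multigrading a, ?_⟩
    rw [pivotMonomial_zero, map_one, mul_one, dehom, MvPolynomial.eval₂Hom_C, val_constLocal]
  · rintro f ⟨e, a⟩ ⟨d, hd, h⟩
    refine ⟨d + Finsupp.single e 1,
      MvPolynomial.IsWeightedHomogeneous.mul hd (X_mem_multigrading e a), ?_⟩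
    have hX : dehom p (MvPolynomial.X (e, a)) = affineCoord p e a := by
      simp [dehom]
    rw [map_mul, map_mul, HomogeneousLocalization.val_mul, pivotMonomial_add, map_mul, hX,
      pivotMonomial_single, ← h, ← val_affineCoord_mul p e a]
    ring

/-- Dehomogenizing divides a form of multidegree `d` by the pivot monomial of that multidegree. It
is checked on monomials, where a nonzero monomial has only one multidegree. -/
theorem val_dehom_mul {d : E →₀ ℕ} {f : CoordRing E K} (hf : f ∈ multigrading E K d) :
    (dehom p f).val * algebraMap (CoordRing E K) _ (pivotMonomial p d) =
      algebraMap (CoordRing E K) _ f := by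
  conv_lhs => rw [f.as_sum]
  conv_rhs => rw [f.as_sum]
  rw [map_sum, map_sum]
  simp only [← HomogeneousLocalization.algebraMap_apply]
  rw [map_sum, Finset.sum_mul]
  refine Finset.sum_congr rfl fun m hm => ?_
  obtain ⟨d', hd', h⟩ := val_dehom_monomial p m (f.coeff m)
  have h1 : MvPolynomial.monomial m (f.coeff m) ∈ multigrading E K d :=
    MvPolynomial.isWeightedHomogeneous_monomial _ _ _ (hf (MvPolynomial.mem_support_iff.1 hm))
  have h2 : MvPolynomial.monomial m (f.coeff m) ≠ 0 := by
    rw [Ne, MvPolynomial.monomial_eq_zero]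
    exact MvPolynomial.mem_support_iff.1 hm
  rw [MvPolynomial.IsWeightedHomogeneous.inj_right h2 h1 hd']
  exact h

/-- Numerator and denominator have the same multidegree, so their pivot monomials cancel: every germ
is a quotient of polynomials in the affine coordinates. -/
theorem mk_mul_dehom (c : HomogeneousLocalization.NumDenSameDeg (multigrading E K)
    (RingHom.ker (evalAt p)).primeCompl) :
    HomogeneousLocalization.mk c * dehom p c.den = dehom p c.num := by
  apply HomogeneousLocalization.val_injective
  apply (isUnit_algebraMap_of_evalAt_ne_zero p
    (evalAt_pivotMonomial_ne_zero p c.deg)).mul_right_cancel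
  rw [HomogeneousLocalization.val_mul, mul_assoc, val_dehom_mul p c.den.2,
    val_dehom_mul p c.num.2, val_mk_mul]

theorem evalLocal_dehom_ne_zero {d : E →₀ ℕ} {f : CoordRing E K} (hf : f ∈ multigrading E K d)
    (h : evalAt p f ≠ 0) : evalLocal p (dehom p f) ≠ 0 := by
  have h1 := evalLocal_mul p _ _ _ (val_dehom_mul p hf)
  intro h0
  rw [h0, zero_mul] at h1
  exact h h1.symm

theorem evalLocal_affineCoord (e : E) (a : Fin 3) :
    evalLocal p (affineCoord p e a) = affineVec p e a := by
  have h := evalLocal_mul p _ _ _ (val_affineCoord_mul p e a)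
  simp only [evalAt, MvPolynomial.eval_X] at h
  rw [affineVec, Pi.smul_apply, smul_eq_mul, ← h, mul_comm, mul_assoc,
    mul_inv_cancel₀ (rep_pivot_ne_zero p e), mul_one]

theorem evalLocal_constLocal (r : K) : evalLocal p (constLocal p r) = r := by
  have h := evalLocal_mul p (constLocal p r) 1 (MvPolynomial.C r)
    (by rw [map_one, mul_one, val_constLocal])
  simpa [evalAt] using h

theorem dehom_X (e : E) (a : Fin 3) : dehom p (MvPolynomial.X (e, a)) = affineCoord p e a := by
  simp [dehom]

theorem dehom_C (r : K) : dehom p (MvPolynomial.C r) = constLocal p r := by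
  simp [dehom]

theorem affineCoord_pivot (e : E) : affineCoord p e (pivot p e) = 1 := by
  apply HomogeneousLocalization.val_injective
  apply (isUnit_algebraMap_of_evalAt_ne_zero p (f := MvPolynomial.X (e, pivot p e))
    (by simpa [evalAt] using rep_pivot_ne_zero p e)).mul_right_cancel
  rw [val_affineCoord_mul, HomogeneousLocalization.val_one, one_mul]

end AffineCoordinates

/-! ### Homomorphisms to the dual numbers as first order deformations -/

section TangentVectors

universe u
variable {E : Type u} [DecidableEq E] {K : Type u} [Field K] {M : Matroid E} {j : Frame M}
  (Q : ModuliPoint M K j)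

theorem dehom_mem_localIdeal {d : E →₀ ℕ} {f : CoordRing E K} (hf : f ∈ multigrading E K d)
    (h : f ∈ equations M K j) : dehom Q.point f ∈ localIdeal Q := by
  let c : HomogeneousLocalization.NumDenSameDeg (multigrading E K)
      (RingHom.ker (evalAt Q.point)).primeCompl :=
    ⟨d, ⟨f, hf⟩, ⟨pivotMonomial Q.point d, pivotMonomial_mem_multigrading Q.point d⟩,
      evalAt_pivotMonomial_ne_zero Q.point d⟩
  refine Ideal.subset_span ⟨c, h, ?_⟩
  apply HomogeneousLocalization.val_injective
  apply (isUnit_algebraMap_of_evalAt_ne_zero Q.point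
    (evalAt_pivotMonomial_ne_zero Q.point d)).mul_right_cancel
  rw [val_dehom_mul Q.point hf]
  exact (val_mk_mul Q.point c).symm

theorem evalLocal_eq_zero_of_mem_localIdeal (z : AmbientLocalRing Q.point)
    (hz : z ∈ localIdeal Q) : evalLocal Q.point z = 0 := by
  have : localIdeal Q ≤ RingHom.ker (evalLocal Q.point) := by
    rw [localIdeal, Ideal.span_le]
    rintro z ⟨c, hc, rfl⟩
    have h := evalLocal_mul Q.point _ _ _ (val_mk_mul Q.point c)
    rw [show evalAt Q.point c.num = 0 from equations_le_ker Q hc] at h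
    exact (mul_eq_zero.1 h).resolve_right c.den_mem
  exact this hz

/-- Evaluation of elements of the local ring of the moduli space. -/
def evalLocalRing : LocalRing Q →+* K :=
  Ideal.Quotient.lift (localIdeal Q) (evalLocal Q.point) (evalLocal_eq_zero_of_mem_localIdeal Q)

/-- The constants in the local ring of the moduli space. -/
def constLocalRing : K →+* LocalRing Q :=
  (Ideal.Quotient.mk (localIdeal Q)).comp (constLocal Q.point)

theorem evalLocalRing_constLocalRing (r : K) : evalLocalRing Q (constLocalRing Q r) = r :=
  evalLocal_constLocal Q.point r

/-- The affine coordinates in the local ring of the moduli space. -/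
def coordLocalRing (e : E) (a : Fin 3) : LocalRing Q :=
  Ideal.Quotient.mk (localIdeal Q) (affineCoord Q.point e a)

variable {Q} {Θ : LocalRing Q →+* DualNumber K}

/-- The derivation vanishes on constants and coordinates, hence on polynomials in them, and by the
quotient rule on all germs, since denominators are nonzero at the point. -/
theorem snd_eq_zero_of_coordLocalRing (h1 : ∀ r, (Θ r).fst = evalLocalRing Q r)
    (h2 : ∀ c, Θ (constLocalRing Q c) = TrivSqZeroExt.inl c)
    (h3 : ∀ e a, (Θ (coordLocalRing Q e a)).snd = 0) (r : LocalRing Q) : (Θ r).snd = 0 := by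
  have key : ∀ f : CoordRing E K,
      (Θ (Ideal.Quotient.mk (localIdeal Q) (dehom Q.point f))).snd = 0 := by
    intro f
    induction f using MvPolynomial.induction_on with
    | C r =>
      rw [dehom_C]
      exact (congrArg TrivSqZeroExt.snd (h2 r)).trans (TrivSqZeroExt.snd_inl _ _)
    | add f g hf hg => rw [map_add, map_add, map_add, TrivSqZeroExt.snd_add, hf, hg, add_zero]
    | mul_X f x hf =>
      rw [map_mul, map_mul, map_mul, DualNumber.snd_mul, hf, dehom_X]
      have := h3 x.1 x.2
      rw [coordLocalRing] at this
      rw [this]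
      simp
  obtain ⟨z, rfl⟩ := Ideal.Quotient.mk_surjective r
  obtain ⟨c, rfl⟩ := HomogeneousLocalization.mk_surjective z
  have h := congrArg (fun z => (Θ (Ideal.Quotient.mk (localIdeal Q) z)).snd)
    (mk_mul_dehom Q.point c)
  simp only [map_mul, DualNumber.snd_mul, key, mul_zero, zero_add] at h
  refine (mul_eq_zero.1 h).resolve_right ?_
  rw [h1]
  exact evalLocal_dehom_ne_zero Q.point c.den.2 c.den_mem

theorem map_coordLocalRing (h1 : ∀ r, (Θ r).fst = evalLocalRing Q r) (e : E) :
    (fun a => Θ (coordLocalRing Q e a)) =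
      dualVec (affineVec Q.point e) fun a => (Θ (coordLocalRing Q e a)).snd := by
  funext a
  ext
  · rw [h1, dualVec, TrivSqZeroExt.fst_add, TrivSqZeroExt.fst_inl, TrivSqZeroExt.fst_inr, add_zero]
    exact evalLocal_affineCoord Q.point e a
  · simp [dualVec]

theorem minor_mem_multigrading (i₁ i₂ i₃ : E) :
    minor (fun e a => (MvPolynomial.X (e, a) : CoordRing E K)) i₁ i₂ i₃ ∈
      multigrading E K (Finsupp.single i₁ 1 + Finsupp.single i₂ 1 + Finsupp.single i₃ 1) := by
  have h : ∀ a b c : Fin 3, (MvPolynomial.X (i₁, a) * MvPolynomial.X (i₂, b) *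
      MvPolynomial.X (i₃, c) : CoordRing E K) ∈
      multigrading E K (Finsupp.single i₁ 1 + Finsupp.single i₂ 1 + Finsupp.single i₃ 1) :=
    fun a b c => MvPolynomial.IsWeightedHomogeneous.mul (MvPolynomial.IsWeightedHomogeneous.mul
      (X_mem_multigrading i₁ a) (X_mem_multigrading i₂ b)) (X_mem_multigrading i₃ c)
  rw [minor, Matrix.det_fin_three]
  exact Submodule.sub_mem _ (Submodule.add_mem _ (Submodule.add_mem _ (Submodule.sub_mem _
    (Submodule.sub_mem _ (h 0 1 2) (h 0 2 1)) (h 1 0 2)) (h 1 2 0)) (h 2 0 1)) (h 2 1 0)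

theorem bracketDeriv_coordLocalRing (h1 : ∀ r, (Θ r).fst = evalLocalRing Q r) {i₁ i₂ i₃ : E}
    (h12 : i₁ ≠ i₂) (h13 : i₁ ≠ i₃) (h23 : i₂ ≠ i₃) (hM : ¬ M.IsBase {i₁, i₂, i₃}) :
    bracketDeriv (affineVec Q.point i₁) (affineVec Q.point i₂) (affineVec Q.point i₃)
      (fun a => (Θ (coordLocalRing Q i₁ a)).snd) (fun a => (Θ (coordLocalRing Q i₂ a)).snd)
      (fun a => (Θ (coordLocalRing Q i₃ a)).snd) = 0 := by
  have h := Ideal.Quotient.eq_zero_iff_mem.2 (dehom_mem_localIdeal Q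
    (minor_mem_multigrading i₁ i₂ i₃)
    (Ideal.subset_span (Or.inl ⟨i₁, i₂, i₃, h12, h13, h23, hM, rfl⟩)))
  rw [minor_eq_bracket, map_bracket, map_bracket] at h
  simp only [dehom_X] at h
  change bracket (coordLocalRing Q i₁) (coordLocalRing Q i₂) (coordLocalRing Q i₃) = 0 at h
  have h' := congrArg Θ h
  rw [map_bracket, map_coordLocalRing h1, map_coordLocalRing h1, map_coordLocalRing h1,
    map_zero] at h'
  rw [← snd_bracket_dualVec, h', TrivSqZeroExt.snd_zero]

theorem exists_affineVec_frame (a : Fin 4) :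
    ∃ r : K, r ≠ 0 ∧ affineVec Q.point (j.atom a) = r • canonicalVec K a := by
  obtain ⟨u, hu⟩ := (Projectivization.mk_eq_mk_iff K _ _ (Q.point (j.atom a)).rep_nonzero
    (canonicalVec_ne_zero K a)).1 ((Projectivization.mk_rep _).trans (Q.point_frame a))
  refine ⟨((Q.point (j.atom a)).rep (pivot Q.point (j.atom a)))⁻¹ * u,
    mul_ne_zero (inv_ne_zero (rep_pivot_ne_zero _ _)) u.ne_zero, ?_⟩
  rw [affineVec, mul_smul]
  congr 1
  exact hu.symm

theorem snd_coordLocalRing_pivot (e : E) :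
    (Θ (coordLocalRing Q e (pivot Q.point e))).snd = 0 := by
  rw [coordLocalRing, affineCoord_pivot, map_one, map_one, TrivSqZeroExt.snd_one]

/-- The frame equation relating coordinate `b` to the pivot is differentiated. The pivot coordinate
is constantly 1, and the pivot entry of the canonical vector is nonzero, so the derivative of
coordinate `b` vanishes. -/
theorem snd_coordLocalRing_frame
    (h2 : ∀ c, Θ (constLocalRing Q c) = TrivSqZeroExt.inl c) (a : Fin 4) (b : Fin 3) :
    (Θ (coordLocalRing Q (j.atom a) b)).snd = 0 := by
  have hmem : ∀ b c : Fin 3, MvPolynomial.C (canonicalVec K a b) * MvPolynomial.X (j.atom a, c) -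
      MvPolynomial.C (canonicalVec K a c) * MvPolynomial.X (j.atom a, b) ∈
      multigrading E K (0 + Finsupp.single (j.atom a) 1) := fun b c =>
    Submodule.sub_mem _
      (MvPolynomial.IsWeightedHomogeneous.mul (C_mem_multigrading _) (X_mem_multigrading _ _))
      (MvPolynomial.IsWeightedHomogeneous.mul (C_mem_multigrading _) (X_mem_multigrading _ _))
  have h := Ideal.Quotient.eq_zero_iff_mem.2 (dehom_mem_localIdeal Q
    (hmem (pivot Q.point (j.atom a)) b) (Ideal.subset_span (Or.inr ⟨a, _, _, rfl⟩)))
  simp only [map_sub, map_mul, dehom_C, dehom_X] at h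
  change constLocalRing Q _ * coordLocalRing Q _ _ - constLocalRing Q _ * coordLocalRing Q _ _ = 0
    at h
  have h' := congrArg (fun r => (Θ r).snd) h
  simp only [map_sub, map_mul, h2, map_zero, TrivSqZeroExt.snd_sub, DualNumber.snd_mul,
    TrivSqZeroExt.fst_inl, TrivSqZeroExt.snd_inl, TrivSqZeroExt.snd_zero, zero_mul, add_zero,
    snd_coordLocalRing_pivot, mul_zero, sub_zero] at h'
  refine (mul_eq_zero.1 h').resolve_left ?_
  intro h0
  obtain ⟨r, -, hr⟩ := exists_affineVec_frame (Q := Q) a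
  have e := affineVec_pivot Q.point (j.atom a)
  rw [hr, Pi.smul_apply, h0, smul_zero] at e
  exact zero_ne_one e

end TangentVectors

/-! ### Realizations of the cyclic matroid as cyclic arrangements, and the conclusion -/

theorem cyclicMatroid_isBase_iff {n : ℕ} (hn : 4 ≤ n) {i j k : ZMod n} (hij : i ≠ j) (hik : i ≠ k)
    (hjk : j ≠ k) : (cyclicMatroid n hn).IsBase {i, j, k} ↔ i + j + k ≠ 0 := by
  change (∃ i' j' k' : ZMod n, i' ≠ j' ∧ i' ≠ k' ∧ j' ≠ k' ∧ i' + j' + k' ≠ 0 ∧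
    ({i, j, k} : Set (ZMod n)) = {i', j', k'}) ↔ _
  constructor
  · rintro ⟨i', j', k', hij', hik', hjk', h, he⟩
    -- Summing over the elements of the finite set shows that the condition does not depend on how
    -- the triple is listed.
    have he' : ({i, j, k} : Finset (ZMod n)) = {i', j', k'} := by
      apply Finset.coe_injective
      simpa using he
    have hs := congrArg (fun s : Finset (ZMod n) => ∑ x ∈ s, x) he'
    rw [Finset.sum_insert (by simp [hij, hik]), Finset.sum_pair hjk,
      Finset.sum_insert (by simp [hij', hik']), Finset.sum_pair hjk'] at hs
    rw [add_assoc, hs, ← add_assoc]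
    exact h
  · intro h
    exact ⟨i, j, k, hij, hik, hjk, h, rfl⟩

theorem cyclicArrangement_affineVec {n : ℕ} {hn : 4 ≤ n} {K : Type} [Field K]
    (P : Realization (cyclicMatroid n hn) K) : CyclicArrangement (affineVec P.point) := by
  intro i j k hij hik hjk
  have h := P.minor_eq_zero_iff i j k hij hik hjk
  rw [cyclicMatroid_isBase_iff hn hij hik hjk, not_not, minor_eq_bracket] at h
  have e : bracket (affineVec P.point i) (affineVec P.point j) (affineVec P.point k) =
      ((P.point i).rep (pivot P.point i))⁻¹ * ((P.point j).rep (pivot P.point j))⁻¹ *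
        ((P.point k).rep (pivot P.point k))⁻¹ *
        bracket (P.point i).rep (P.point j).rep (P.point k).rep := by
    simp only [affineVec, bracket, Pi.smul_apply, smul_eq_mul]
    ring
  rw [e]
  constructor
  · intro h0
    rw [h.2 h0, mul_zero]
  · intro h0
    exact isUnit_iff_ne_zero.2 (mul_ne_zero (mul_ne_zero (mul_ne_zero
      (inv_ne_zero (rep_pivot_ne_zero _ _)) (inv_ne_zero (rep_pivot_ne_zero _ _)))
      (inv_ne_zero (rep_pivot_ne_zero _ _))) (mt h.1 h0))

end MatroidRealization

end

theorem mainTheorem5 (n : ℕ) (hn : 10 ≤ n)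
    (P : MatroidRealization.Realization (cyclicMatroid n (by omega)) ℂ)
    (j : MatroidRealization.Frame (cyclicMatroid n (by omega))) :
    Module.rank (IsLocalRing.ResidueField (MatroidRealization.LocalRing (P.toModuliPoint j)))
      (MatroidRealization.TangentSpace (P.toModuliPoint j)) ≤ 1 := by
  set Q := P.toModuliPoint j
  have hp := MatroidRealization.cyclicArrangement_affineVec Q.toRealization
  refine (rank_dual_cotangentSpace_le (MatroidRealization.evalLocalRing_constLocalRing Q)
    (MatroidRealization.coordLocalRing Q)
    (deformationSpace (MatroidRealization.affineVec Q.point)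
      (MatroidRealization.pivot Q.point) j.atom) ?_ ?_).trans
    (hp.rank_deformationSpace_le hn ?_ MatroidRealization.exists_affineVec_frame)
  · exact fun Θ h1 h2 h3 => MatroidRealization.snd_eq_zero_of_coordLocalRing h1 h2 h3
  · intro Θ h1 h2
    refine ⟨fun i j k hij hik hjk h => ?_, fun k => ?_, fun a => ?_⟩
    · refine MatroidRealization.bracketDeriv_coordLocalRing h1 hij hik hjk ?_
      rw [MatroidRealization.cyclicMatroid_isBase_iff _ hij hik hjk, not_not]
      exact h
    · exact MatroidRealization.snd_coordLocalRing_pivot k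
    · funext b
      exact MatroidRealization.snd_coordLocalRing_frame h2 a b
  · intro k
    rw [MatroidRealization.affineVec_pivot]
    exact one_ne_zero
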